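/- Let $G$ be a finite group and let $V$ be a $G$-universe, i.e. a real inner product $G$-module (with its norm topology) that is linearly and equivariantly isometric to the direct sum of countably many copies of the regular representation $\mathbb{R}[G]$. Spaces of configurations below, their products and the domains of their homotopies carry the compactly generated topology. Let $M$ be a $G$-partial monoid: a pointed $G$-space whose points are closed (for example a weak Hausdorff space), with $G$-invariant sets $M_n\subset M^n$ of summable $n$-tuples and $G$-maps $M_n\to M$, $(a_1,\dots,a_n)\mapsto a_1+\cdots+a_n$, such that $M_0$ is a point with image the base point $0$, $M_1\to M$ is the identity, and, whenever $\{1,\dots,n\}=J_1\sqcup\dots\sqcup J_r$ and every block $(a_j)_{j\in J_k}$ is summable, $(a_1,\dots,a_n)$ is summable if and only if the $r$-tuple of block sums is, in which case the two sums agree. For a pointed space $N$ with such partial sums (whose continuity plays no role here), $C(V,N)$ is the set of pairs $(c,a)$ of a finite set $c\subset V$ and a map $a\colon c\to N$, where points labeled $0$ may be deleted. It has the quotient topology from the disjoint union over $n$ of the compactly generated spaces of tuples $((v_i,a_i))_{i\le n}\in (V\times N)^n$ in which the labels of the particles at each point of $V$ are summable; such a tuple is sent to the configuration whose label at each point is that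 sum. The group $G$ acts by $g(c,a)=(gc,gag^{-1})$, and the base point is $\emptyset$. Let $I(\mathbb{R})_+$ be the partial monoid, under disjoint union, of finite unions $P$ of pairwise disjoint closed bounded intervals of positive length, topologized by their end points (the number of intervals being locally constant). The smash product $I(\mathbb{R})_+\wedge M$ is the pointed smash product, in which a tuple has sum $P\wedge a$ if its formal sum can be transformed into $P\wedge a$ by the distributivity relations $\sum_i (P_i\wedge a)=(\bigcup_i P_i)\wedge a$ ($P_i$ pairwise disjoint) and $\sum_i(P\wedge a_i)=P\wedge(\sum_i a_i)$ ($(a_i)$ summable). Put $$I_+(V,M)=C(V,I(\mathbb{R})_+\wedge M).$$ A point of $I_+(V,M)$ is thus a finite set of pairwise disjoint labeled strings $(\{v_i\}\times J_i,a_i)$, strings over the same $v$ having the same label. Choose a linear embedding $e\colon\mathbb{R}\to V^G$ and a $G$-linear isometry (not necessarily onto) $l\colon V\times V\to V$, and define $$\lambda\colon I_+(V,M)\to C(V,M),\qquad \{(\{v_i\}\times J_i,a_i)\}\mapsto\{(l(v_i,e(\hat J_i)),a_i)\},$$ where $\hat J_i$ is the midpoint of $J_i$. The multiplication of $C(V,N)$,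 for $N=M$ or $N=I(\mathbb{R})_+\wedge M$, is given by distinct points $p_1,p_2\in V^G$ and a $G$-linear isometry $l'\colon V\times V\to V$: the product of $x$ and $y$ is the union of the image of $x$ under $v\mapsto l'(p_1,v)$ and of the image of $y$ under $v\mapsto l'(p_2,v)$, with the same labels. Then, for all such choices of $e$ and $l$, the map $\lambda$ is a (pointed) $G$-homotopy equivalence: it is a continuous pointed $G$-map with a $G$-homotopy inverse. Moreover, for all choices of $(p_1,p_2,l')$, made independently for $I_+(V,M)$ and for $C(V,M)$, both spaces are Hopf $G$-spaces (the multiplication is a pointed $G$-map, and $\emptyset$ is a two-sided unit up to $G$-homotopy), and $\lambda$ is a map of Hopf $G$-spaces: it commutes with the multiplications up to $G$-homotopy. -/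

import Mathlib

open Set Topology

universe u v w

namespace LabeledStrings

/-! ### Partial abelian monoids -/

/-- A partial abelian monoid.  `IsSum s x` says that the tuple of elements listed by `s`
(a tuple of length `n = card s`, in any order) belongs to the set `M_n` of summable `n`-tuples
and that its sum is `x`. Independence of the order is the case of one-element blocks of the
associativity axiom of partial abelian monoids, so nothing is lost by using multisets. -/
class PartialMonoid (M : Type v) extends Zero M where
  IsSum : Multiset M → M → Prop
  isSum_unique : ∀ {s : Multiset M} {x y : M}, IsSum s x → IsSum s y → x = y
  isSum_nil : IsSum 0 0
  isSum_singleton : ∀ a : M, IsSum {a} a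
  /-- If a tuple is cut into (possibly empty) summable blocks `S` with sums `t`, then the whole
  tuple is summable if and only if the tuple of block sums is, and then the sums agree. -/
  isSum_join : ∀ {S : Multiset (Multiset M)} {t : Multiset M}, Multiset.Rel IsSum S t →
    ∀ x : M, IsSum S.join x ↔ IsSum t x

open PartialMonoid (IsSum)

/-- `f` is continuous on the compactly generated space underlying `X`: it is continuous along
every continuous map from a compact Hausdorff space. -/
def KContinuous {X : Type w} {Y : Type v} [TopologicalSpace X] [TopologicalSpace Y]
    (f : X → Y) : Prop :=
  ∀ (K : Type w) [TopologicalSpace K] [CompactSpace K] [T2Space K] (c : K → X),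
    Continuous c → Continuous (f ∘ c)

/-- A partial abelian monoid with `G`-action, for a discrete group `G`: a pointed `G`-space,
the sets `M_n` are invariant, and the maps `M_n → M` are equivariant and continuous (for the
compactly generated topology of `M_n`). -/
class GPartialMonoid (G : Type w) (M : Type v) [Group G] [TopologicalSpace M]
    [PartialMonoid M] extends MulAction G M, SMulZeroClass G M where
  continuous_act : ∀ g : G, Continuous (fun a : M => g • a)
  isSum_smul : ∀ (g : G) {s : Multiset M} {x : M},
    IsSum s x → IsSum (s.map (fun a => g • a)) (g • x)
  continuous_sum : ∀ (n : ℕ) (σ : {a : Fin n → M // ∃ x, IsSum (Finset.univ.val.map a) x} → M),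
    (∀ a, IsSum (Finset.univ.val.map a.1) (σ a)) → KContinuous σ

/-! ### Labeled configurations -/

/-- The set `C(V,N)`: pairs of a finite subset `c` of `V` and a map `c → N`, where points
labeled `0` may be dropped; in other words finitely supported functions from `V` to `N`. -/
def Config (V : Type u) (N : Type v) [Zero N] : Type (max u v) := V →₀ N

/-- A configuration as a finitely supported function, the label at each point. -/
def Config.labels {V : Type u} {N : Type v} [Zero N] (f : Config V N) : V →₀ N := f

instance (V : Type u) (N : Type v) [Zero N] : Zero (Config V N) :=
  inferInstanceAs (Zero (V →₀ N))

open Classical in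
/-- The tuple of particles `(p i, x i)`, some of which may be at the same place, superimposes
to the configuration `f`: for each `z` in `V` the labels of the particles at `z` are summable,
with sum `f z`. -/
def Superimposes {V : Type u} {N : Type v} [PartialMonoid N] {n : ℕ}
    (p : Fin n → V) (x : Fin n → N) (f : Config V N) : Prop :=
  ∀ z : V, IsSum ((Finset.univ.filter (fun i => p i = z)).val.map x) (f.labels z)

/-- The topology of `C(V,N)`: the quotient topology from the disjoint union over `n` of the
compactly generated spaces of tuples of `n` particles that can be superimposed.  So positions
and labels move continuously, particles with label `0` can be deleted or created, and particles
that collide with summable labels have their labels added. -/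
instance (V : Type u) (N : Type v) [TopologicalSpace V] [TopologicalSpace N] [PartialMonoid N] :
    TopologicalSpace (Config V N) where
  IsOpen W := ∀ (K : Type (max u v)) [TopologicalSpace K] [CompactSpace K] [T2Space K]
    (n : ℕ) (p : K → Fin n → V) (x : K → Fin n → N) (F : K → Config V N),
    Continuous p → Continuous x → (∀ k, Superimposes (p k) (x k) (F k)) → IsOpen (F ⁻¹' W)
  isOpen_univ := by
    intros
    simp
  isOpen_inter := by
    intro s t hs ht K _ _ _ n p x F hp hx hF
    exact (hs K n p x F hp hx hF).inter (ht K n p x F hp hx hF)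
  isOpen_sUnion := by
    intro s hs K _ _ _ n p x F hp hx hF
    rw [preimage_sUnion]
    exact isOpen_biUnion fun t ht => hs t ht K n p x F hp hx hF

/-- The action of `G` on `C(V,N)`: it moves the points and acts on the labels. -/
noncomputable instance (G : Type w) (V : Type u) (N : Type v) [Group G] [MulAction G V] [Zero N]
    [SMulZeroClass G N] : SMul G (Config V N) where
  smul g f := Finsupp.equivMapDomain (MulAction.toPerm g)
    (Finsupp.mapRange (fun a : N => g • a) (smul_zero g) f.labels)

/-! ### Smash products -/

/-- The relation that collapses the wedge in a product of pointed sets. -/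
def smashSetoid (X : Type u) (Y : Type v) [Zero X] [Zero Y] : Setoid (X × Y) where
  r p q := p = q ∨ ((p.1 = 0 ∨ p.2 = 0) ∧ (q.1 = 0 ∨ q.2 = 0))
  iseqv := ⟨fun _ => Or.inl rfl, by rintro p q (h | h); exacts [Or.inl h.symm, Or.inr h.symm],
    by
      rintro p q r (rfl | h) (rfl | h')
      exacts [Or.inl rfl, Or.inr h', Or.inr h, Or.inr ⟨h.1, h'.2⟩]⟩

/-- The smash product of pointed spaces. -/
def Smash (X : Type u) (Y : Type v) [Zero X] [Zero Y] : Type (max u v) :=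
  Quotient (smashSetoid X Y)

/-- The point `x ∧ y` of the smash product. -/
def Smash.mk {X : Type u} {Y : Type v} [Zero X] [Zero Y] (x : X) (y : Y) : Smash X Y :=
  Quotient.mk (smashSetoid X Y) (x, y)

instance (X : Type u) (Y : Type v) [Zero X] [Zero Y] : Zero (Smash X Y) := ⟨Smash.mk 0 0⟩

instance (X : Type u) (Y : Type v) [Zero X] [Zero Y] [TopologicalSpace X] [TopologicalSpace Y] :
    TopologicalSpace (Smash X Y) :=
  inferInstanceAs (TopologicalSpace (Quotient (smashSetoid X Y)))

/-- The distributivity relations between formal sums of elements of the smash product. -/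
inductive Distrib (X : Type u) (Y : Type v) [PartialMonoid X] [PartialMonoid Y] :
    Multiset (Smash X Y) → Multiset (Smash X Y) → Prop
  | left (s : Multiset X) (c : X) (d : Y) (h : IsSum s c) :
      Distrib X Y (s.map fun c' => Smash.mk c' d) {Smash.mk c d}
  | right (c : X) (s : Multiset Y) (d : Y) (h : IsSum s d) :
      Distrib X Y (s.map fun d' => Smash.mk c d') {Smash.mk c d}

/-- The formal sum `s` of elements of the smash product can be summed up to the element `z`
by using the distributivity relations. -/
def SmashSum {X : Type u} {Y : Type v} [PartialMonoid X] [PartialMonoid Y]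
    (s : Multiset (Smash X Y)) (z : Smash X Y) : Prop :=
  addConGen (Distrib X Y) s {z}

/-! ### The space of closed intervals -/

/-- The set `I(ℝ)₊` of finite unions of pairwise disjoint closed bounded intervals (of positive
length).  A union `P` is recorded by the finite set of its connected components, the interval
`[a,b]` being written as the pair `(a, b)`. -/
@[ext] structure IPlus where
  intervals : Finset (ℝ × ℝ)
  lt : ∀ J ∈ intervals, J.1 < J.2
  disj : (intervals : Set (ℝ × ℝ)).PairwiseDisjoint (fun J => Icc J.1 J.2)

/-- The multiset of components of `P`. -/
def IPlus.components (P : IPlus) : Multiset (ℝ × ℝ) := P.intervals.val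

/-- The empty union is the base point. -/
instance : Zero IPlus := ⟨⟨∅, by simp, by simp⟩⟩

/-- `r` pairwise disjoint closed intervals, in any order, given by their end points. -/
def IntervalTuple (r : ℕ) : Type :=
  {x : Fin r → ℝ × ℝ // (∀ i, (x i).1 < (x i).2) ∧
    Pairwise fun i j => Disjoint (Icc (x i).1 (x i).2) (Icc (x j).1 (x j).2)}

instance (r : ℕ) : TopologicalSpace (IntervalTuple r) :=
  inferInstanceAs (TopologicalSpace (Subtype _))

open Classical in
/-- The union of a tuple of pairwise disjoint closed intervals. -/
noncomputable def IntervalTuple.union {r : ℕ} (x : IntervalTuple r) : IPlus where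
  intervals := Finset.univ.image x.1
  lt := by
    intro J hJ
    obtain ⟨i, -, rfl⟩ := Finset.mem_image.1 hJ
    exact x.2.1 i
  disj := by
    intro J hJ J' hJ' hne
    obtain ⟨i, -, rfl⟩ := Finset.mem_image.1 (Finset.mem_coe.1 hJ)
    obtain ⟨j, -, rfl⟩ := Finset.mem_image.1 (Finset.mem_coe.1 hJ')
    exact x.2.2 fun h => hne (congrArg x.1 h)

/-- The topology of `I(ℝ)₊`: the end points move continuously and the number of closed intervals
is locally constant, as disjoint closed intervals can neither be concatenated nor vanish. -/
noncomputable instance : TopologicalSpace IPlus :=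
  ⨆ r : ℕ, TopologicalSpace.coinduced (IntervalTuple.union (r := r)) inferInstance

/-- `I(ℝ)₊` is a partial abelian monoid under disjoint union.  As `P` consists of distinct,
pairwise disjoint intervals, the equation of multisets says exactly that the members of `s` are
pairwise disjoint and that their union is `P`. -/
instance : PartialMonoid IPlus where
  IsSum s P := (s.map IPlus.components).sum = P.components
  isSum_unique h h' := IPlus.ext (Finset.val_injective (h.symm.trans h'))
  isSum_nil := rfl
  isSum_singleton a := by simp
  isSum_join := by
    intro S t h x
    suffices (S.join.map IPlus.components).sum = (t.map IPlus.components).sum by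
      rw [this]
    induction h with
    | zero => rfl
    | cons hab _ ih =>
      rw [Multiset.join_cons, Multiset.map_add, Multiset.sum_add, ih, hab, Multiset.map_cons,
        Multiset.sum_cons]

/-! ### Strings with labels: `I(ℝ)₊ ∧ M` as a partial abelian monoid -/

section Strings

variable {M : Type v}

open Classical in
/-- The intervals of `P` in an element `P ∧ a` (none if `a = 0`). -/
noncomputable def strings [Zero M] (z : Smash IPlus M) : Finset (ℝ × ℝ) :=
  Quotient.lift (s := smashSetoid IPlus M)
    (fun q => if q.2 = 0 then (∅ : Finset (ℝ × ℝ)) else q.1.intervals) (by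
      rintro ⟨P, a⟩ ⟨Q, b⟩ (h | ⟨h, h'⟩)
      · rw [h]
      · have key : ∀ (P : IPlus) (a : M), P = 0 ∨ a = 0 →
            (if a = 0 then (∅ : Finset (ℝ × ℝ)) else P.intervals) = ∅ := by
          rintro P a (rfl | rfl)
          · split_ifs <;> rfl
          · simp
        exact (key P a h).trans (key Q b h').symm) z

open Classical in
/-- The label `a` of an element `P ∧ a` (which is `0` if `P` is empty). -/
noncomputable def label [Zero M] (z : Smash IPlus M) : M :=
  Quotient.lift (s := smashSetoid IPlus M)
    (fun q => if q.1 = 0 then (0 : M) else q.2) (by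
      rintro ⟨P, a⟩ ⟨Q, b⟩ (h | ⟨h, h'⟩)
      · rw [h]
      · have key : ∀ (P : IPlus) (a : M), P = 0 ∨ a = 0 →
            (if P = 0 then (0 : M) else a) = 0 := by
          rintro P a (rfl | rfl) <;> simp
        exact (key P a h).trans (key Q b h').symm) z

/-- `G` acts trivially on `I(ℝ)₊`, so it acts on `I(ℝ)₊ ∧ M` through the labels. -/
instance (G : Type w) [Zero M] [SMulZeroClass G M] : SMulZeroClass G (Smash IPlus M) where
  smul g := Quotient.map (sa := smashSetoid IPlus M) (sb := smashSetoid IPlus M)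
    (fun q => (q.1, g • q.2)) (by
      rintro ⟨P, a⟩ ⟨Q, b⟩ (h | ⟨h, h'⟩)
      · rw [h]
      · refine Or.inr ⟨h.imp id fun h => ?_, h'.imp id fun h => ?_⟩
        · change g • a = 0
          rw [show a = 0 from h, smul_zero]
        · change g • b = 0
          rw [show b = 0 from h, smul_zero])
  smul_zero g := by
    change Smash.mk (0 : IPlus) (g • (0 : M)) = Smash.mk 0 0
    rw [smul_zero]

/-- Two formal sums in `M` that can replace each other in every sum. -/
def Interchangeable [PartialMonoid M] (s t : Multiset M) : Prop :=
  ∀ (r : Multiset M) (x : M), IsSum (s + r) x ↔ IsSum (t + r) x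

theorem IsSum.interchangeable [PartialMonoid M] {s : Multiset M} {y : M} (h : IsSum s y) :
    Interchangeable s {y} := by
  intro r x
  have hr : Multiset.Rel (IsSum (M := M)) (r.map fun a => {a}) r := by
    induction r using Multiset.induction_on with
    | empty => exact Multiset.Rel.zero
    | cons a r ih =>
      rw [Multiset.map_cons]
      exact Multiset.Rel.cons (PartialMonoid.isSum_singleton a) ih
  have := PartialMonoid.isSum_join (Multiset.Rel.cons h hr) x
  have hj : (r.map fun a => ({a} : Multiset M)).join = r := by
    clear this hr
    induction r using Multiset.induction_on with
    | empty => rfl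
    | cons a r ih => rw [Multiset.map_cons, Multiset.join_cons, ih, Multiset.singleton_add]
  rw [Multiset.join_cons, hj] at this
  simpa using this

theorem Interchangeable.refl [PartialMonoid M] (s : Multiset M) : Interchangeable s s :=
  fun _ _ => Iff.rfl

theorem Interchangeable.symm [PartialMonoid M] {s t : Multiset M} (h : Interchangeable s t) :
    Interchangeable t s := fun r x => (h r x).symm

theorem Interchangeable.trans [PartialMonoid M] {s t r : Multiset M} (h : Interchangeable s t)
    (h' : Interchangeable t r) : Interchangeable s r := fun q x => (h q x).trans (h' q x)

theorem Interchangeable.add [PartialMonoid M] {s t s' t' : Multiset M} (h : Interchangeable s t)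
    (h' : Interchangeable s' t') : Interchangeable (s + s') (t + t') := by
  intro r x
  rw [add_assoc, h, ← add_assoc, add_comm t, add_assoc, h', ← add_assoc, add_comm t']

theorem Interchangeable.eq [PartialMonoid M] {a b : M} (h : Interchangeable {a} {b}) : a = b := by
  have := h 0 a
  simp only [add_zero] at this
  exact PartialMonoid.isSum_unique (this.1 (PartialMonoid.isSum_singleton a))
    (PartialMonoid.isSum_singleton b)

theorem zero_interchangeable [PartialMonoid M] : Interchangeable (0 : Multiset M) {0} :=
  IsSum.interchangeable PartialMonoid.isSum_nil

open Classical in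
/-- The labels of the string `J` in a formal sum. -/
noncomputable def labelsAt [Zero M] (J : ℝ × ℝ) (s : Multiset (Smash IPlus M)) : Multiset M :=
  (s.filter fun z => J ∈ strings z).map label

open Classical in
theorem strings_mk [Zero M] (P : IPlus) (a : M) :
    strings (Smash.mk P a) = if a = 0 then ∅ else P.intervals := rfl

open Classical in
theorem label_mk [Zero M] (P : IPlus) (a : M) :
    label (Smash.mk P a) = if P = 0 then 0 else a := rfl

theorem IPlus.ne_zero_of_mem {P : IPlus} {J : ℝ × ℝ} (h : J ∈ P.intervals) : P ≠ 0 := by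
  rintro rfl
  exact absurd h (Finset.notMem_empty J)

theorem labelsAt_add [Zero M] (J : ℝ × ℝ) (s t : Multiset (Smash IPlus M)) :
    labelsAt J (s + t) = labelsAt J s + labelsAt J t := by
  simp [labelsAt]

open Classical in
theorem labelsAt_cons [Zero M] (J : ℝ × ℝ) (z : Smash IPlus M) (s : Multiset (Smash IPlus M)) :
    labelsAt J (z ::ₘ s) = (if J ∈ strings z then {label z} else 0) + labelsAt J s := by
  rw [← Multiset.singleton_add, labelsAt_add]
  congr 1
  by_cases h : J ∈ strings z <;> simp [labelsAt, h, Multiset.filter_singleton]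

theorem labelsAt_zero [Zero M] (J : ℝ × ℝ) : labelsAt J (0 : Multiset (Smash IPlus M)) = 0 := by
  simp [labelsAt]

open Classical in
theorem labelsAt_singleton [Zero M] (J : ℝ × ℝ) (z : Smash IPlus M) :
    labelsAt J {z} = if J ∈ strings z then {label z} else 0 := by
  rw [← Multiset.cons_zero, labelsAt_cons, labelsAt_zero, add_zero]

theorem labelsAt_distrib [PartialMonoid M] (J : ℝ × ℝ) {s t : Multiset (Smash IPlus M)}
    (h : Distrib IPlus M s t) : Interchangeable (labelsAt J s) (labelsAt J t) := by
  classical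
  cases h with
  | left s c d h =>
    have key : ∀ s : Multiset IPlus, labelsAt J (s.map fun c' => Smash.mk c' d) =
        if d = 0 then 0
        else Multiset.replicate ((s.map IPlus.components).sum.count J) d := by
      intro s
      induction s using Multiset.induction_on with
      | empty => simp [labelsAt_zero]
      | cons Q s ih =>
        rw [Multiset.map_cons, labelsAt_cons, ih, strings_mk, label_mk]
        by_cases hd : d = 0
        · simp [hd]
        · by_cases hJ : J ∈ Q.intervals
          · have hc : Multiset.count J Q.components = 1 :=
              Multiset.count_eq_one_of_mem Q.intervals.nodup hJ
            simp [hd, hJ, IPlus.ne_zero_of_mem hJ, hc, Multiset.replicate_add]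
          · have hc : Multiset.count J Q.components = 0 := Multiset.count_eq_zero.2 hJ
            simp [hd, hJ, hc]
    have h1 := key s
    have h2 := key {c}
    have h' : (s.map IPlus.components).sum = c.components := h
    rw [h'] at h1
    rw [Multiset.map_singleton, Multiset.map_singleton, Multiset.sum_singleton] at h2
    rw [h1, h2]
    exact Interchangeable.refl _
  | right c s d h =>
    have key : ∀ s : Multiset M, Interchangeable (labelsAt J (s.map fun d' => Smash.mk c d'))
        (if J ∈ c.intervals then s else 0) := by
      intro s
      induction s using Multiset.induction_on with
      | empty =>
        rw [Multiset.map_zero, labelsAt_zero, ite_self]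
        exact Interchangeable.refl _
      | cons a s ih =>
        rw [Multiset.map_cons, labelsAt_cons, strings_mk, label_mk]
        by_cases hJ : J ∈ c.intervals
        · rw [if_pos hJ] at ih ⊢
          rw [← Multiset.singleton_add]
          refine Interchangeable.add ?_ ih
          by_cases ha : a = 0
          · simpa [ha] using zero_interchangeable
          · simpa [ha, hJ, IPlus.ne_zero_of_mem hJ] using Interchangeable.refl _
        · rw [if_neg hJ] at ih ⊢
          have : J ∉ (if a = 0 then ∅ else c.intervals) := by split_ifs <;> simp [hJ]
          rwa [if_neg this, zero_add]
    have h1 := key s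
    have h2 := key {d}
    rw [Multiset.map_singleton] at h2
    refine h1.trans (Interchangeable.trans ?_ h2.symm)
    split_ifs
    · exact IsSum.interchangeable h
    · exact Interchangeable.refl _

theorem SmashSum.labelsAt [PartialMonoid M] (J : ℝ × ℝ) {s t : Multiset (Smash IPlus M)}
    (h : addConGen (Distrib IPlus M) s t) :
    Interchangeable (labelsAt J s) (labelsAt J t) := by
  let c : AddCon (Multiset (Smash IPlus M)) :=
    { r := fun s t => Interchangeable (LabeledStrings.labelsAt J s) (LabeledStrings.labelsAt J t)
      iseqv := ⟨fun _ => Interchangeable.refl _, fun h => h.symm, fun h h' => h.trans h'⟩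
      add' := by
        intro a b c d h h'
        rw [labelsAt_add, labelsAt_add]
        exact h.add h' }
  have hc : addConGen (Distrib IPlus M) ≤ c :=
    AddCon.addConGen_le.2 fun s t h => labelsAt_distrib J h
  exact hc h

theorem Smash.mk_eq_zero [Zero M] {P : IPlus} {a : M} (h : P = 0 ∨ a = 0) :
    Smash.mk P a = 0 := Quotient.sound (Or.inr ⟨h, Or.inl rfl⟩)

theorem SmashSum.unique [PartialMonoid M] {s : Multiset (Smash IPlus M)} {y z : Smash IPlus M}
    (hy : SmashSum s y) (hz : SmashSum s z) : y = z := by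
  classical
  have h : addConGen (Distrib IPlus M) {y} {z} :=
    (addConGen (Distrib IPlus M)).trans ((addConGen (Distrib IPlus M)).symm hy) hz
  clear hy hz
  -- If `J` is a string of `P ∧ a` with `a ≠ 0`, it is one of `Q ∧ b`, with `b = a`.
  have key : ∀ (P Q : IPlus) (a b : M) (J : ℝ × ℝ),
      addConGen (Distrib IPlus M) {Smash.mk P a} {Smash.mk Q b} → a ≠ 0 → J ∈ P.intervals →
      J ∈ Q.intervals ∧ a = b := by
    intro P Q a b J h ha hJ
    have := SmashSum.labelsAt J h
    rw [labelsAt_singleton, labelsAt_singleton, strings_mk, strings_mk, label_mk, label_mk,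
      if_neg ha, if_pos hJ, if_neg (IPlus.ne_zero_of_mem hJ)] at this
    by_cases hb : b = 0
    · rw [if_pos hb, if_neg (Finset.notMem_empty J)] at this
      exact absurd (this.trans zero_interchangeable).eq ha
    · rw [if_neg hb] at this
      by_cases hQ : J ∈ Q.intervals
      · rw [if_pos hQ, if_neg (IPlus.ne_zero_of_mem hQ)] at this
        exact ⟨hQ, this.eq⟩
      · rw [if_neg hQ] at this
        exact absurd (this.trans zero_interchangeable).eq ha
  have triv : ∀ (P : IPlus) (a : M), (P = 0 ∨ a = 0) ∨ (a ≠ 0 ∧ ∃ J, J ∈ P.intervals) := by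
    intro P a
    by_cases ha : a = 0
    · exact Or.inl (Or.inr ha)
    · rcases P.intervals.eq_empty_or_nonempty with hP | hP
      · exact Or.inl (Or.inl (IPlus.ext hP))
      · exact Or.inr ⟨ha, hP⟩
  induction y using Quotient.inductionOn with | h p => ?_
  induction z using Quotient.inductionOn with | h q => ?_
  obtain ⟨P, a⟩ := p
  obtain ⟨Q, b⟩ := q
  change addConGen (Distrib IPlus M) {Smash.mk P a} {Smash.mk Q b} at h
  change Smash.mk P a = Smash.mk Q b
  have h' := (addConGen (Distrib IPlus M)).symm h
  rcases triv P a with h0 | ⟨ha, J, hJ⟩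
  · rcases triv Q b with h1 | ⟨hb, J, hJ⟩
    · rw [Smash.mk_eq_zero h0, Smash.mk_eq_zero h1]
    · obtain ⟨hJ', hab⟩ := key Q P b a J h' hb hJ
      rcases h0 with h0 | h0
      · exact absurd h0 (IPlus.ne_zero_of_mem hJ')
      · exact absurd (hab.trans h0) hb
  · obtain ⟨-, rfl⟩ := key P Q a b J h ha hJ
    have : P = Q := IPlus.ext (Finset.ext fun J =>
      ⟨fun hJ => (key P Q a a J h ha hJ).1, fun hJ => (key Q P a a J h' ha hJ).1⟩)
    rw [this]

/-- The smash product `I(ℝ)₊ ∧ M` of partial abelian monoids. -/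
instance [PartialMonoid M] : PartialMonoid (Smash IPlus M) where
  IsSum := SmashSum
  isSum_unique := SmashSum.unique
  isSum_nil := AddConGen.Rel.of _ _ (Distrib.left 0 0 0 PartialMonoid.isSum_nil)
  isSum_singleton z := (addConGen (Distrib IPlus M)).refl {z}
  isSum_join := by
    intro S t h x
    have hSt : addConGen (Distrib IPlus M) S.join t := by
      induction h with
      | zero => exact (addConGen (Distrib IPlus M)).refl 0
      | cons hab _ ih =>
        rw [Multiset.join_cons, ← Multiset.singleton_add]
        exact (addConGen (Distrib IPlus M)).add hab ih
    exact ⟨fun hx => (addConGen (Distrib IPlus M)).trans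
      ((addConGen (Distrib IPlus M)).symm hSt) hx,
      fun hx => (addConGen (Distrib IPlus M)).trans hSt hx⟩

end Strings

/-- The space `I₊(V,M) = C(V, I(ℝ)₊ ∧ M)` of closed strings in `V × ℝ` with labels in `M`. -/
abbrev StringConfig (V : Type u) (M : Type v) [PartialMonoid M] : Type (max u v) :=
  Config V (Smash IPlus M)

/-! ### Universes and the choices involved -/

/-- `V` is a `G`-universe: it is linearly and equivariantly isometric to the direct sum of
countably many copies of the real regular representation of `G`, whose elements are real
functions on `G`, the elements of `G` being an orthonormal basis permuted by left translation. -/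
def IsUniverse (G : Type w) (V : Type u) [Group G] [Fintype G] [NormedAddCommGroup V]
    [InnerProductSpace ℝ V] [MulAction G V] : Prop :=
  ∃ φ : V ≃ₗ[ℝ] (ℕ →₀ G → ℝ),
    (∀ x y : V, inner ℝ x y = (φ x).sum fun n a => ∑ h : G, a h * φ y n h) ∧
    ∀ (g : G) (x : V) (n : ℕ) (h : G), φ (g • x) n h = φ x n (g⁻¹ * h)

/-- A `G`-linear isometry `V × V → V` (not necessarily onto), `V × V` having the product inner
product. -/
structure GIsometry (G : Type w) (V : Type u) [Group G] [NormedAddCommGroup V]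
    [InnerProductSpace ℝ V] [MulAction G V] where
  toIsometry : WithLp 2 (V × V) →ₗᵢ[ℝ] V
  equivariant : ∀ (g : G) (x y : V), toIsometry (WithLp.toLp 2 (g • x, g • y)) =
    g • toIsometry (WithLp.toLp 2 (x, y))

section Choices

variable {G : Type w} {V : Type u} [Group G] [NormedAddCommGroup V] [InnerProductSpace ℝ V]
  [MulAction G V]

/-- The value `l(x,y)`. -/
noncomputable def GIsometry.app (l : GIsometry G V) (x y : V) : V := l.toIsometry (WithLp.toLp 2 (x, y))

theorem GIsometry.app_inj (l : GIsometry G V) {x y x' y' : V} (h : l.app x y = l.app x' y') :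
    x = x' ∧ y = y' := by
  have := WithLp.toLp_injective 2 (l.toIsometry.injective h)
  exact ⟨congrArg Prod.fst this, congrArg Prod.snd this⟩

variable (G V) in
/-- A linear embedding `ℝ → V^G`. -/
structure LineEmbedding where
  toLinear : ℝ →ₗ[ℝ] V
  injective : Function.Injective toLinear
  fixed : ∀ (g : G) (s : ℝ), g • toLinear s = toLinear s

/-- The embedding `V × ℝ → V`, `(x,s) ↦ l(x, e(s))`. -/
noncomputable def position (e : LineEmbedding G V) (l : GIsometry G V) : V × ℝ ↪ V where
  toFun q := l.app q.1 (e.toLinear q.2)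
  inj' := by
    rintro ⟨x, s⟩ ⟨y, t⟩ h
    obtain ⟨h1, h2⟩ := l.app_inj h
    exact Prod.ext h1 (e.injective h2)

variable (G V) in
/-- The choices in the Hopf structure: an embedding of two points into `V^G` and a `G`-linear
isometry `V × V → V`. -/
structure HopfChoice where
  pt₁ : V
  pt₂ : V
  ne : pt₁ ≠ pt₂
  fixed₁ : ∀ g : G, g • pt₁ = pt₁
  fixed₂ : ∀ g : G, g • pt₂ = pt₂
  isom : GIsometry G V

/-- The equivariant embedding of two copies of `V` into `V` given by such choices. -/
noncomputable def HopfChoice.embedding (j : HopfChoice G V) : V ⊕ V ↪ V where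
  toFun := Sum.elim (fun x => j.isom.app j.pt₁ x) (fun x => j.isom.app j.pt₂ x)
  inj' := by
    rintro (x | x) (y | y) h
    · exact congrArg Sum.inl (j.isom.app_inj h).2
    · exact absurd (j.isom.app_inj h).1 j.ne
    · exact absurd (j.isom.app_inj h).1 j.ne.symm
    · exact congrArg Sum.inr (j.isom.app_inj h).2

/-- The multiplication of `C(V,N)`: the two configurations, placed in the two copies of `V`,
are moved into `V` by the embedding, with their labels. -/
noncomputable def hopfMul {N : Type v} [Zero N] (j : HopfChoice G V) (x y : Config V N) :
    Config V N :=
  Finsupp.embDomain j.embedding (Finsupp.sumElim x.labels y.labels)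

end Choices

/-! ### The map `λ` -/

/-- The midpoint of an interval. -/
noncomputable def midpt (J : ℝ × ℝ) : ℝ := (J.1 + J.2) / 2

open Classical in
/-- The labeled midpoints `(v, Ĵ)` in `V × ℝ` of the strings `{v} × J`. -/
noncomputable def midpoints {V : Type u} {M : Type v} [PartialMonoid M] (f : StringConfig V M) :
    V × ℝ →₀ M :=
  Finsupp.onFinset
    (f.labels.support.biUnion fun x =>
      (strings (f.labels x)).image fun J => (x, midpt J))
    (fun q => if ∃ J ∈ strings (f.labels q.1), midpt J = q.2
      then label (f.labels q.1) else 0)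
    (by
      rintro ⟨x, s⟩ hq
      split_ifs at hq with h
      · obtain ⟨J, hJ, hs⟩ := h
        refine Finset.mem_biUnion.2 ⟨x, Finsupp.mem_support_iff.2 fun h0 => ?_,
          Finset.mem_image.2 ⟨J, hJ, by rw [show midpt J = s from hs]⟩⟩
        rw [h0] at hJ
        change J ∈ strings (Smash.mk (0 : IPlus) (0 : M)) at hJ
        rw [strings_mk, if_pos rfl] at hJ
        exact absurd hJ (Finset.notMem_empty J)
      · exact absurd rfl hq)

/-- The map `λ : I₊(V,M) → C(V,M)` that sends a string `{v} × J` with label `a` to the particle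
at `l(v, e(Ĵ))` with label `a`, where `Ĵ` is the midpoint of `J`. -/
noncomputable def lambda {G : Type w} {V : Type u} {M : Type v} [Group G] [NormedAddCommGroup V]
    [InnerProductSpace ℝ V] [MulAction G V] [PartialMonoid M] (e : LineEmbedding G V)
    (l : GIsometry G V) (f : StringConfig V M) : Config V M :=
  Finsupp.embDomain (position e l) (midpoints f)

/-! ### Equivariant homotopy and Hopf spaces -/

section Homotopy

variable (G : Type w) {X Y : Type u} [TopologicalSpace X] [TopologicalSpace Y] [Zero X] [Zero Y]
  [SMul G X] [SMul G Y]

/-- Pointed equivariant homotopy of maps. -/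
def GHomotopic (f f' : X → Y) : Prop :=
  ∃ H : unitInterval → X → Y, KContinuous (fun q : unitInterval × X => H q.1 q.2) ∧
    (∀ x, H 0 x = f x) ∧ (∀ x, H 1 x = f' x) ∧
    (∀ t (g : G) x, H t (g • x) = g • H t x) ∧ ∀ t, H t 0 = 0

/-- Continuous pointed equivariant maps. -/
def IsPointedGMap (f : X → Y) : Prop :=
  Continuous f ∧ (∀ (g : G) x, f (g • x) = g • f x) ∧ f 0 = 0

/-- `G`-homotopy equivalences. -/
def IsGHomotopyEquiv (f : X → Y) : Prop :=
  IsPointedGMap G f ∧ ∃ f' : Y → X, IsPointedGMap G f' ∧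
    GHomotopic G (f' ∘ f) id ∧ GHomotopic G (f ∘ f') id

/-- `X` is a Hopf `G`-space with multiplication `m`, whose unit is the base point: `m` is a
`G`-map from the (compactly generated) product, and multiplication by the unit from either side
is `G`-homotopic to the identity. -/
def IsHopfGSpace (m : X → X → X) : Prop :=
  KContinuous (fun q : X × X => m q.1 q.2) ∧ (∀ (g : G) x y, m (g • x) (g • y) = g • m x y) ∧
    m 0 0 = 0 ∧ GHomotopic G (fun x => m x 0) id ∧ GHomotopic G (fun x => m 0 x) id

/-- `f` is a map of Hopf `G`-spaces. -/
def IsHopfGMap (m : X → X → X) (m' : Y → Y → Y) (f : X → Y) : Prop :=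
  IsPointedGMap G f ∧
    GHomotopic G (fun q : X × X => f (m q.1 q.2)) (fun q : X × X => m' (f q.1) (f q.2))

end Homotopy

end LabeledStrings

open LabeledStrings

namespace LabeledStrings

/-! ### Interchangeable formal sums -/

/-! All maps and homotopies in question are obtained by moving particles. If `IsPush θ g g'`, the
configuration `g'` arises from `g` by moving its points along a map `θ` of positions that is
injective on them. Such a `g'` is unique, so identities between maps of configurations
(equivariance, values at the base point, ends of homotopies) reduce to identities between maps of
positions. If `θ` is continuous, so is the map of configurations, and a continuous family of maps
`θ` gives a homotopy.

To treat strings in the same way, a point of `I₊(V,M)` is read through `strands` as a configuration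
in `V × Strand` with labels in `M`: a string is a particle whose position includes its interval.
Then `λ` is the move `(x,J) ↦ l(x, e(Ĵ))`, and the multiplications are moves too. The midpoint map
is not injective on `V × Strand`, but it is injective on the strings of any one configuration, as
disjoint intervals have different midpoints.

The topological core is `isGenerated_strands`: the topology of `I₊(V,M)` is also the final one for
continuous families of finitely many strings with labels in `M`. A continuous family of particles
labeled in `I(ℝ)₊ ∧ M` over a compact `K` does not list its strings continuously. Away from the base
point, however, the number, the end points and the inverse lengths of the strings are bounded over
`K` (`exists_sum_strings_le`). The enumerations of the strings, arbitrary where the label is `0`,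
therefore form a compact space over `K`, and its projection to `K` is a quotient map.

The geometric input is `IsUniverse.homotopicThrough`: two continuous equivariant injections into `V`
are homotopic through such injections, by shifting them to complementary summands of the universe
and interpolating. This gives the unit laws, the compatibility of `λ` with the multiplications, and
one of the two homotopies for the inverse, which puts the string `[-1,1]` with the same label over
each particle. The other homotopy, from `ι ∘ λ` to the identity, first restores the intervals while
all strings lie over different points, then collects the strings over each original point, and
finally moves an embedding of `V` to the identity. -/

theorem interchangeable_singleton_iff {M : Type*} [PartialMonoid M] {s : Multiset M} {y : M} :
    Interchangeable s {y} ↔ PartialMonoid.IsSum s y := by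
  refine ⟨fun h => ?_, IsSum.interchangeable⟩
  have := (h 0 y).2
  simp only [add_zero] at this
  exact this (PartialMonoid.isSum_singleton y)

/-- Unlike summability, interchangeability is compatible with addition of formal sums. Partial sums
can thus be evaluated block by block without checking at each stage that the blocks are summable
together. -/
theorem Interchangeable.finset_sum {M ι : Type*} [PartialMonoid M] (E : Finset ι)
    {S T : ι → Multiset M} (h : ∀ i ∈ E, Interchangeable (S i) (T i)) :
    Interchangeable (∑ i ∈ E, S i) (∑ i ∈ E, T i) := by
  classical
  induction E using Finset.induction_on with
  | empty => exact Interchangeable.refl _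
  | insert a E ha ih =>
    rw [Finset.sum_insert ha, Finset.sum_insert ha]
    exact (h a (Finset.mem_insert_self a E)).add
      (ih fun i hi => h i (Finset.mem_insert_of_mem hi))

/-! ### Families of particles -/

open Classical in
/-- The labels of the particles at `z`. -/
noncomputable def labelsOver {A M : Type*} (s : Multiset (A × M)) (z : A) : Multiset M :=
  (s.filter fun y => y.1 = z).map Prod.snd

/-- The family `s` of particles superimposes to the configuration `g`. -/
def Represents {A : Type u} {M : Type v} [PartialMonoid M] (s : Multiset (A × M))
    (g : Config A M) : Prop :=
  ∀ z, Interchangeable (labelsOver s z) {g.labels z}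

section Particles

variable {A B A' B' : Type*} {M : Type v}

theorem labelsOver_zero (z : A) : labelsOver (0 : Multiset (A × M)) z = 0 := by
  simp [labelsOver]

open Classical in
theorem labelsOver_cons (y : A × M) (s : Multiset (A × M)) (z : A) :
    labelsOver (y ::ₘ s) z = (if y.1 = z then {y.2} else 0) + labelsOver s z := by
  by_cases h : y.1 = z <;> simp [labelsOver, h]

theorem labelsOver_add (s t : Multiset (A × M)) (z : A) :
    labelsOver (s + t) z = labelsOver s z + labelsOver t z := by
  simp [labelsOver]

/-- The particles that land at `z` are sorted by their origin. Since `E` only has to contain the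
origins that occur, the fibre of `θ` may be infinite. -/
theorem labelsOver_map_eq_sum (θ : A → B) (z : B) (E : Finset A) (hE : ∀ e ∈ E, θ e = z)
    (s : Multiset (A × M)) (hs : ∀ y ∈ s, θ y.1 = z → y.1 ∈ E) :
    labelsOver (s.map (Prod.map θ id)) z = ∑ e ∈ E, labelsOver s e := by
  classical
  induction s using Multiset.induction_on with
  | empty => simp [labelsOver_zero]
  | cons y s ih =>
    rw [Multiset.map_cons, labelsOver_cons, ih fun y hy => hs y (Multiset.mem_cons_of_mem hy)]
    simp only [labelsOver_cons, Finset.sum_add_distrib, Finset.sum_ite_eq]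
    have := hs y (Multiset.mem_cons_self y s)
    congr 1
    by_cases h : θ y.1 = z
    · simp [h, this h]
    · have : y.1 ∉ E := fun h' => h (hE _ h')
      simp [h, this]

theorem labelsOver_map_of_injective {f : A → B} (hf : Function.Injective f)
    (s : Multiset (A × M)) (z : A) :
    labelsOver (s.map (Prod.map f id)) (f z) = labelsOver s z := by
  rw [labelsOver_map_eq_sum f (f z) {z} (by simp) s, Finset.sum_singleton]
  intro y _ h
  exact Finset.mem_singleton.2 (hf h)

theorem labelsOver_eq_zero {s : Multiset (A × M)} {z : A} (h : ∀ y ∈ s, y.1 ≠ z) :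
    labelsOver s z = 0 := by
  classical
  rw [labelsOver, Multiset.filter_eq_nil.2 h, Multiset.map_zero]

theorem superimposes_iff [PartialMonoid M] {n : ℕ} {p : Fin n → A} {x : Fin n → M}
    {f : Config A M} :
    Superimposes p x f ↔ Represents (Finset.univ.val.map fun i => (p i, x i)) f := by
  classical
  unfold Superimposes Represents
  simp only [interchangeable_singleton_iff]
  refine forall_congr' fun z => ?_
  have : (Finset.univ.filter fun i => p i = z).val.map x =
      labelsOver (Finset.univ.val.map fun i => (p i, x i)) z := by
    rw [labelsOver, Multiset.filter_map, Multiset.map_map]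
    rfl
  rw [← this]

/-! ### Moving configurations along maps of positions -/

/-- `g'` is the configuration obtained from `g` by moving its points along `θ`, which has to be
injective on them. -/
structure IsPush [Zero M] (θ : A → B) (g : Config A M) (g' : Config B M) : Prop where
  injOn : ∀ e e', g.labels e ≠ 0 → g.labels e' ≠ 0 → θ e = θ e' → e = e'
  apply : ∀ e, g.labels e ≠ 0 → g'.labels (θ e) = g.labels e
  exists_of_ne : ∀ z, g'.labels z ≠ 0 → ∃ e, g.labels e ≠ 0 ∧ θ e = z

theorem Config.ext [Zero M] {g g' : Config A M} (h : ∀ z, g.labels z = g'.labels z) : g = g' :=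
  Finsupp.ext h

@[simp] theorem Config.labels_zero [Zero M] (z : A) : (0 : Config A M).labels z = 0 := rfl

theorem Config.labels_smul {G : Type*} [Group G] [MulAction G A] [Zero M] [SMulZeroClass G M]
    (g : G) (f : Config A M) (z : A) : (g • f).labels z = g • f.labels (g⁻¹ • z) := rfl

namespace IsPush

theorem eq_zero_or [Zero M] {θ : A → B} {g : Config A M} {g' : Config B M}
    (h : IsPush θ g g') (z : B) :
    (g'.labels z = 0 ∧ ∀ e, θ e = z → g.labels e = 0) ∨
      ∃ e, θ e = z ∧ g'.labels z = g.labels e ∧ ∀ e', θ e' = z → e' ≠ e → g.labels e' = 0 := by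
  by_cases hz : ∃ e, g.labels e ≠ 0 ∧ θ e = z
  · obtain ⟨e, he, rfl⟩ := hz
    refine Or.inr ⟨e, rfl, h.apply e he, fun e' h1 h2 => ?_⟩
    by_contra h3
    exact h2 (h.injOn e' e h3 he h1)
  · refine Or.inl ⟨?_, fun e he => ?_⟩
    · by_contra h0
      exact hz (h.exists_of_ne z h0)
    · by_contra h0
      exact hz ⟨e, h0, he⟩

/-- A move is determined by its map of positions. This is the source of the equalities of maps and
of the values of homotopies below. -/
theorem unique [Zero M] {θ : A → B} {g : Config A M} {g' g'' : Config B M}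
    (h : IsPush θ g g') (h' : IsPush θ g g'') : g' = g'' := by
  have key : ∀ {g' g'' : Config B M}, IsPush θ g g' → IsPush θ g g'' → ∀ z, g'.labels z ≠ 0 →
      g'.labels z = g''.labels z := by
    intro g' g'' h h' z hz
    obtain ⟨e, he, rfl⟩ := h.exists_of_ne z hz
    rw [h.apply e he, h'.apply e he]
  refine Config.ext fun z => ?_
  by_cases hz : g'.labels z = 0
  · by_cases hz' : g''.labels z = 0
    · rw [hz, hz']
    · exact (key h' h z hz').symm
  · exact key h h' z hz

theorem comp [Zero M] {C : Type*} {θ : A → B} {θ' : B → C} {g : Config A M} {g' : Config B M}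
    {g'' : Config C M} (h' : IsPush θ' g' g'') (h : IsPush θ g g') : IsPush (θ' ∘ θ) g g'' where
  injOn e e' he he' hh :=
    h.injOn e e' he he' (h'.injOn _ _ (by rwa [h.apply e he]) (by rwa [h.apply e' he']) hh)
  apply e he := by
    have := h.apply e he
    rw [Function.comp_apply, h'.apply _ (by rwa [this]), this]
  exists_of_ne z hz := by
    obtain ⟨y, hy, rfl⟩ := h'.exists_of_ne z hz
    obtain ⟨e, he, rfl⟩ := h.exists_of_ne y hy
    exact ⟨e, he, rfl⟩

protected theorem id [Zero M] (g : Config A M) : IsPush id g g :=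
  ⟨fun _ _ _ _ h => h, fun _ _ => rfl, fun z hz => ⟨z, hz, rfl⟩⟩

theorem zero [Zero M] (θ : A → B) : IsPush θ (0 : Config A M) 0 :=
  ⟨fun _ _ h => absurd rfl h, fun _ h => absurd rfl h, fun _ h => absurd rfl h⟩

theorem smul {G : Type*} [Group G] [MulAction G A] [MulAction G B] [Zero M] [SMulZeroClass G M]
    (c : G) (hc : ∀ a : M, c • a = 0 → a = 0) {θ : A → B} (hθ : ∀ (c : G) a, θ (c • a) = c • θ a)
    {g : Config A M} {g' : Config B M} (h : IsPush θ g g') : IsPush θ (c • g) (c • g') := by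
  have ne : ∀ a : M, c • a ≠ 0 ↔ a ≠ 0 := fun a =>
    not_congr ⟨hc a, fun h => by rw [h, smul_zero]⟩
  constructor
  · intro e e' he he' hh
    rw [Config.labels_smul, ne] at he he'
    exact MulAction.injective c⁻¹ (h.injOn _ _ he he' (by rw [hθ, hθ, hh]))
  · intro e he
    rw [Config.labels_smul, ne] at he
    rw [Config.labels_smul, Config.labels_smul, ← hθ, h.apply _ he]
  · intro z hz
    rw [Config.labels_smul, ne] at hz
    obtain ⟨e, he, hz⟩ := h.exists_of_ne _ hz
    refine ⟨c • e, ?_, by rw [hθ, hz, smul_inv_smul]⟩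
    rwa [Config.labels_smul, ne, inv_smul_smul]

theorem _root_.LabeledStrings.exists_isPush [Zero M] (θ : A → B) (g : Config A M)
    (h : ∀ e e', g.labels e ≠ 0 → g.labels e' ≠ 0 → θ e = θ e' → e = e') :
    ∃ g', IsPush θ g g' := by
  classical
  let f : B → M := fun z =>
    if hz : ∃ e, g.labels e ≠ 0 ∧ θ e = z then g.labels hz.choose else 0
  have hf : ∀ z, f z ≠ 0 → ∃ e, g.labels e ≠ 0 ∧ θ e = z := by
    intro z hz
    by_contra h0
    exact hz (dif_neg h0)
  let g' : B →₀ M := Finsupp.onFinset (g.labels.support.image θ) f (by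
    intro z hz
    obtain ⟨e, he, rfl⟩ := hf z hz
    exact Finset.mem_image_of_mem θ (Finsupp.mem_support_iff.2 he))
  refine ⟨g', h, fun e he => ?_, hf⟩
  have hz : ∃ e', g.labels e' ≠ 0 ∧ θ e' = θ e := ⟨e, he, rfl⟩
  change f (θ e) = g.labels e
  rw [show f (θ e) = g.labels hz.choose from dif_pos hz,
    h _ _ hz.choose_spec.1 he hz.choose_spec.2]

theorem embDomain [Zero M] (θ : A ↪ B) (g : Config A M) :
    IsPush θ g (Finsupp.embDomain θ g.labels : Config B M) where
  injOn _ _ _ _ h := θ.injective h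
  apply e _ := Finsupp.embDomain_apply_self θ g.labels e
  exists_of_ne z hz := by
    by_cases h : z ∈ Set.range θ
    · obtain ⟨e, rfl⟩ := h
      refine ⟨e, ?_, rfl⟩
      rwa [← Finsupp.embDomain_apply_self θ g.labels e]
    · exact absurd (Finsupp.embDomain_of_notMem_range θ g.labels z h) hz

end IsPush

/-- Away from the points of `g` there may be particles whose non-zero labels add up to `0`, and `θ`
may send these anywhere. Sorted by origin, the labels arriving at `z` form blocks with sums
`g.labels e`. At most one of these sums is non-zero, and the zeros can be dropped. -/
theorem Represents.map [PartialMonoid M] {s : Multiset (A × M)} {g : Config A M}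
    {g' : Config B M} {θ : A → B} (hs : Represents s g) (h : IsPush θ g g') :
    Represents (s.map (Prod.map θ id)) g' := by
  classical
  intro z
  -- The support of `g` is included so that a point `e` over `z` outside `E` is known to have label
  -- `0`.
  set E : Finset A := ((s.map Prod.fst).toFinset ∪ g.labels.support).filter fun e => θ e = z
  have hE : ∀ e ∈ E, θ e = z := fun e he => (Finset.mem_filter.1 he).2
  rw [labelsOver_map_eq_sum θ z E hE s fun y hy hz => Finset.mem_filter.2
    ⟨Finset.mem_union_left _ (Multiset.mem_toFinset.2 (Multiset.mem_map_of_mem _ hy)), hz⟩]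
  rcases h.eq_zero_or z with ⟨h0, h1⟩ | ⟨e, rfl, h0, h1⟩
  · rw [h0]
    have : Interchangeable (∑ e ∈ E, labelsOver s e) (∑ e ∈ E, 0) :=
      Interchangeable.finset_sum E fun e he => by
        have := hs e
        rw [h1 e (hE e he)] at this
        exact this.trans zero_interchangeable.symm
    rw [Finset.sum_const_zero] at this
    exact this.trans zero_interchangeable
  · rw [h0]
    have : Interchangeable (∑ e' ∈ E, labelsOver s e')
        (∑ e' ∈ E, if e = e' then {g.labels e} else 0) :=
      Interchangeable.finset_sum E fun e' he => by
        split_ifs with hee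
        · exact hee ▸ hs e
        · have := hs e'
          rw [h1 e' (hE e' he) fun h => hee h.symm] at this
          exact this.trans zero_interchangeable.symm
    rw [Finset.sum_ite_eq] at this
    by_cases he : e ∈ E
    · rwa [if_pos he] at this
    · rw [if_neg he] at this
      have h2 : g.labels e = 0 := by
        by_contra h2
        exact he (Finset.mem_filter.2
          ⟨Finset.mem_union_right _ (Finsupp.mem_support_iff.2 h2), rfl⟩)
      rw [h2]
      exact this.trans zero_interchangeable

/-! ### Pairs of configurations -/

/-- Two configurations as a configuration in the disjoint union. -/
noncomputable def Config.pair [Zero M] (x : Config A M) (y : Config B M) : Config (A ⊕ B) M :=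
  Finsupp.sumElim x.labels y.labels

@[simp] theorem Config.pair_inl [Zero M] (x : Config A M) (y : Config B M) (a : A) :
    (x.pair y).labels (Sum.inl a) = x.labels a := Finsupp.sumElim_inl x.labels y.labels a

@[simp] theorem Config.pair_inr [Zero M] (x : Config A M) (y : Config B M) (b : B) :
    (x.pair y).labels (Sum.inr b) = y.labels b := Finsupp.sumElim_inr x.labels y.labels b

theorem Represents.pair [PartialMonoid M] {s : Multiset (A × M)} {t : Multiset (B × M)}
    {x : Config A M} {y : Config B M} (hs : Represents s x) (ht : Represents t y) :
    Represents (s.map (Prod.map Sum.inl id) + t.map (Prod.map Sum.inr id)) (x.pair y) := by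
  rintro (z | z)
  · rw [labelsOver_add, labelsOver_map_of_injective Sum.inl_injective, 
      labelsOver_eq_zero (s := t.map _), add_zero, Config.pair_inl]
    · exact hs z
    · intro y hy
      obtain ⟨y, -, rfl⟩ := Multiset.mem_map.1 hy
      simp
  · rw [labelsOver_add, labelsOver_map_of_injective Sum.inr_injective,
      labelsOver_eq_zero (s := s.map _),
      zero_add, Config.pair_inr]
    · exact ht z
    · intro y hy
      obtain ⟨y, -, rfl⟩ := Multiset.mem_map.1 hy
      simp

theorem IsPush.pair [Zero M] {θ : A → A'} {η : B → B'} {x : Config A M} {y : Config B M}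
    {x' : Config A' M} {y' : Config B' M} (h : IsPush θ x x') (h' : IsPush η y y') :
    IsPush (Sum.map θ η) (x.pair y) (x'.pair y') where
  injOn := by
    rintro (a | a) (b | b) ha hb hab
    · exact congrArg _ (h.injOn a b (by simpa using ha) (by simpa using hb) (by simpa using hab))
    · simp at hab
    · simp at hab
    · exact congrArg _ (h'.injOn a b (by simpa using ha) (by simpa using hb) (by simpa using hab))
  apply := by
    rintro (a | a) ha
    · simpa using h.apply a (by simpa using ha)
    · simpa using h'.apply a (by simpa using ha)
  exists_of_ne := by
    rintro (z | z) hz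
    · obtain ⟨e, he, rfl⟩ := h.exists_of_ne z (by simpa using hz)
      exact ⟨Sum.inl e, by simpa using he, rfl⟩
    · obtain ⟨e, he, rfl⟩ := h'.exists_of_ne z (by simpa using hz)
      exact ⟨Sum.inr e, by simpa using he, rfl⟩

theorem IsPush.inl [Zero M] (x : Config A M) :
    IsPush Sum.inl x (x.pair (0 : Config B M)) where
  injOn _ _ _ _ h := Sum.inl_injective h
  apply e _ := Config.pair_inl x 0 e
  exists_of_ne := by
    rintro (z | z) hz
    · exact ⟨z, by simpa using hz, rfl⟩
    · simp at hz

theorem IsPush.inr [Zero M] (y : Config B M) :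
    IsPush Sum.inr y ((0 : Config A M).pair y) where
  injOn _ _ _ _ h := Sum.inr_injective h
  apply e _ := Config.pair_inr 0 y e
  exists_of_ne := by
    rintro (z | z) hz
    · simp at hz
    · exact ⟨z, by simpa using hz, rfl⟩

end Particles

/-! ### Spaces generated by continuous families of particles -/

section Generated

variable {A B A' : Type u} {M : Type v} [TopologicalSpace A] [TopologicalSpace B]
  [TopologicalSpace A'] [TopologicalSpace M] [PartialMonoid M]
  {X Y X' : Type max u v}

/-- `F` is represented by a continuous family of tuples of particles in `A` with labels in `M`. -/
def IsTest {K : Type*} [TopologicalSpace K] (d : X → Config A M) (F : K → X) : Prop :=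
  ∃ (n : ℕ) (q : K → Fin n → A) (a : K → Fin n → M), Continuous q ∧ Continuous a ∧
    ∀ k, Represents (Finset.univ.val.map fun i => (q k i, a k i)) (d (F k))

theorem IsTest.of_fintype {K : Type*} [TopologicalSpace K] {d : X → Config A M} {F : K → X}
    {ι : Type*} [Fintype ι] {q : K → ι → A} {a : K → ι → M} (hq : Continuous q)
    (ha : Continuous a)
    (h : ∀ k, Represents (Finset.univ.val.map fun i => (q k i, a k i)) (d (F k))) :
    IsTest d F := by
  refine ⟨Fintype.card ι, fun k i => q k ((Fintype.equivFin ι).symm i),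
    fun k i => a k ((Fintype.equivFin ι).symm i), by fun_prop, by fun_prop, fun k => ?_⟩
  convert h k using 1
  have := Finset.map_univ_equiv (Fintype.equivFin ι).symm
  conv_rhs => rw [← this]
  rw [Finset.map_val, Multiset.map_map]
  rfl

theorem IsTest.comp {K L : Type*} [TopologicalSpace K] [TopologicalSpace L]
    {d : X → Config A M} {F : K → X} (h : IsTest d F) {c : L → K} (hc : Continuous c) :
    IsTest d (F ∘ c) := by
  obtain ⟨n, q, a, hq, ha, h⟩ := h
  exact ⟨n, q ∘ c, a ∘ c, hq.comp hc, ha.comp hc, fun k => h (c k)⟩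

theorem IsTest.push {K : Type*} [TopologicalSpace K] {d : X → Config A M} {F : K → X}
    {d' : Y → Config B M} {F' : K → Y} (h : IsTest d F) {Θ : K → A → B}
    (hΘ : Continuous fun y : K × A => Θ y.1 y.2)
    (hF : ∀ k, IsPush (Θ k) (d (F k)) (d' (F' k))) : IsTest d' F' := by
  obtain ⟨n, q, a, hq, ha, h⟩ := h
  refine ⟨n, fun k i => Θ k (q k i), a, continuous_pi fun i => ?_, ha, fun k => ?_⟩
  · exact hΘ.comp (continuous_id.prodMk ((continuous_apply i).comp hq))
  · have := (h k).map (hF k)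
    rwa [Multiset.map_map] at this

/-- The configuration in the disjoint union given by a pair of points. -/
noncomputable def pairMap (d : X → Config A M) (d' : Y → Config B M) (z : X × Y) :
    Config (A ⊕ B) M := (d z.1).pair (d' z.2)

theorem IsTest.pair {K : Type*} [TopologicalSpace K] {d : X → Config A M} {F : K → X}
    {d' : Y → Config B M} {F' : K → Y} (h : IsTest d F) (h' : IsTest d' F') :
    IsTest (pairMap d d') fun k => (F k, F' k) := by
  obtain ⟨n, q, a, hq, ha, h⟩ := h
  obtain ⟨n', q', a', hq', ha', h'⟩ := h'
  refine IsTest.of_fintype (ι := Fin n ⊕ Fin n')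
    (q := fun k => Sum.elim (fun i => Sum.inl (q k i)) fun i => Sum.inr (q' k i))
    (a := fun k => Sum.elim (a k) (a' k)) ?_ ?_ fun k => ?_
  · refine continuous_pi ?_
    rintro (i | i)
    · exact continuous_inl.comp ((continuous_apply i).comp hq)
    · exact continuous_inr.comp ((continuous_apply i).comp hq')
  · refine continuous_pi ?_
    rintro (i | i)
    · exact (continuous_apply i).comp ha
    · exact (continuous_apply i).comp ha'
  · convert (h k).pair (h' k) using 1
    rw [← Finset.univ_disjSum_univ, Finset.val_disjSum, Multiset.disjSum, Multiset.map_add,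
      Multiset.map_map, Multiset.map_map, Multiset.map_map, Multiset.map_map]
    · rfl
    · rfl

/-- The topology of `X` is the final one with respect to the continuous families of tuples of
particles over compact Hausdorff spaces. -/
structure IsGenerated [TopologicalSpace X] (d : X → Config A M) : Prop where
  continuous_of_isTest : ∀ (K : Type max u v) [TopologicalSpace K] [CompactSpace K] [T2Space K]
    (F : K → X), IsTest d F → Continuous F
  isOpen_of_isTest : ∀ W : Set X, (∀ (K : Type max u v) [TopologicalSpace K] [CompactSpace K]
    [T2Space K] (F : K → X), IsTest d F → IsOpen (F ⁻¹' W)) → IsOpen W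

/-- A map on `[0,1] × X` is continuous for the compactly generated topology if it is so on
continuous families of tuples of particles. -/
def IsKGenerated [TopologicalSpace X] (d : X → Config A M) : Prop :=
  ∀ (Y : Type max u v) [TopologicalSpace Y] (H : unitInterval → X → Y),
    (∀ (K : Type max u v) [TopologicalSpace K] [CompactSpace K] [T2Space K] (F : K → X),
      IsTest d F → Continuous fun q : unitInterval × K => H q.1 (F q.2)) →
    KContinuous fun q : unitInterval × X => H q.1 q.2

/-! ### Continuity tested on families of particles -/

namespace IsGenerated

variable [TopologicalSpace X] [TopologicalSpace Y] {d : X → Config A M} {d' : Y → Config B M}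

theorem continuous_iff (h : IsGenerated d) {Z : Type*} [TopologicalSpace Z] {f : X → Z}
    (hf : ∀ (K : Type max u v) [TopologicalSpace K] [CompactSpace K] [T2Space K] (F : K → X),
      IsTest d F → Continuous (f ∘ F)) : Continuous f :=
  ⟨fun _ hW => h.isOpen_of_isTest _ fun K _ _ _ F hF => hW.preimage (hf K F hF)⟩

/-- The product with a compact Hausdorff space `T` respects final topologies because `T` is
exponentiable: continuity on `T × X` is continuity of the adjoint `X → C(T, Z)`, which can be tested
on families of particles. -/
theorem continuous_prod (h : IsGenerated d) {Z T : Type*} [TopologicalSpace Z]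
    [TopologicalSpace T] [CompactSpace T] [T2Space T] {f : T → X → Z}
    (hf : ∀ (K : Type max u v) [TopologicalSpace K] [CompactSpace K] [T2Space K] (F : K → X),
      IsTest d F → Continuous fun q : T × K => f q.1 (F q.2)) :
    Continuous fun q : T × X => f q.1 q.2 := by
  have hc : ∀ x, Continuous fun t => f t x := by
    intro x
    -- a single point is represented by the particles of its configuration
    have hx : IsTest d fun _ : PUnit.{max u v + 1} => x := by
      refine IsTest.of_fintype (ι := (d x).labels.support) (q := fun _ i => i.1)
        (a := fun _ i => (d x).labels i.1) continuous_const continuous_const fun _ z => ?_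
      have h0 := IsPush.id (d x)
      classical
      rw [labelsOver, Multiset.filter_map, Multiset.map_map]
      by_cases hz : (d x).labels z = 0
      · rw [Multiset.filter_eq_nil.2, Multiset.map_zero, hz]
        · exact zero_interchangeable
        · rintro ⟨i, hi⟩ - rfl
          exact Finsupp.mem_support_iff.1 hi hz
      · have h1 : Multiset.filter (fun i : (d x).labels.support => i.1 = z) Finset.univ.val =
            {⟨z, Finsupp.mem_support_iff.2 hz⟩} := by
          rw [← Finset.filter_val, ← Finset.singleton_val]
          congr 1
          ext i
          simp [Subtype.ext_iff]
        erw [h1]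
        exact Interchangeable.refl _
    exact (hf _ _ hx).comp (f := fun t : T => (t, PUnit.unit)) (by fun_prop)
  let φ : X → C(T, Z) := fun x => ⟨fun t => f t x, hc x⟩
  have hφ : Continuous φ := h.continuous_iff fun K _ _ _ F hF =>
    ContinuousMap.continuous_of_continuous_uncurry _ ((hf K F hF).comp continuous_swap)
  exact (ContinuousMap.continuous_uncurry_of_continuous ⟨φ, hφ⟩).comp continuous_swap

theorem isKGenerated (h : IsGenerated d) : IsKGenerated d := fun _ _ _ hH _ _ _ _ _ hc =>
  (h.continuous_prod hH).comp hc

/-- The two factors are treated one at a time, the remaining variables being parameters in a compact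
Hausdorff space. This is why the compactly generated topology of the product is needed: the second
factor is pulled back to `K` before the first one varies over all of `X`. -/
theorem isKGenerated_prod (h : IsGenerated d) (h' : IsGenerated d') :
    IsKGenerated (pairMap d d') := by
  intro Z _ H hH K _ _ _ c hc
  have h1 : ∀ (K₁ : Type max u v) [TopologicalSpace K₁] [CompactSpace K₁] [T2Space K₁]
      (F : K₁ → X), IsTest d F → Continuous
        fun q : (unitInterval × K) × K₁ => H q.1.1 (F q.2, (c q.1.2).2.2) := by
    intro K₁ _ _ _ F hF
    have h2 : Continuous fun q : (unitInterval × K₁) × Y => H q.1.1 (F q.1.2, q.2) := by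
      refine h'.continuous_prod (f := fun (q : unitInterval × K₁) y => H q.1 (F q.2, y))
        fun K₂ _ _ _ F' hF' => ?_
      have := hH (K₁ × K₂) (fun k => (F k.1, F' k.2))
        ((hF.comp continuous_fst).pair (hF'.comp continuous_snd))
      exact this.comp (f := fun q : (unitInterval × K₁) × K₂ => (q.1.1, (q.1.2, q.2)))
        (by fun_prop)
    exact h2.comp (f := fun q : (unitInterval × K) × K₁ => ((q.1.1, q.2), (c q.1.2).2.2))
      (by fun_prop)
  have h2 := h.continuous_prod (f := fun (q : unitInterval × K) x => H q.1 (x, (c q.2).2.2)) h1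
  -- Restriction to the diagonal: the parameter `k` and the point of `X` are again tied together by
  -- `c`.
  exact h2.comp (f := fun k => (((c k).1, k), (c k).2.1)) (by fun_prop)

/-- A map that moves the particles by a continuous map is continuous. -/
theorem continuous_of_isPush (h : IsGenerated d) (h' : IsGenerated d') {f : X → Y} {θ : A → B}
    (hθ : Continuous θ) (hf : ∀ x, IsPush θ (d x) (d' (f x))) : Continuous f :=
  h.continuous_iff fun K _ _ _ F hF => h'.continuous_of_isTest K _
    (hF.push (Θ := fun _ => θ) (hθ.comp continuous_snd) fun k => hf (F k))

end IsGenerated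

theorem isGenerated_config : IsGenerated (id : Config A M → Config A M) where
  continuous_of_isTest K _ _ _ F := by
    rintro ⟨n, q, a, hq, ha, h⟩
    exact ⟨fun _ hW => hW K n q a F hq ha fun k => superimposes_iff.2 (h k)⟩
  isOpen_of_isTest _ hW K _ _ _ n q a F hq ha h :=
    hW K F ⟨n, q, a, hq, ha, fun k => superimposes_iff.1 (h k)⟩

theorem IsKGenerated.kContinuous_homotopy [TopologicalSpace X] [TopologicalSpace Y]
    {d : X → Config A M} {d' : Y → Config B M} (h : IsKGenerated d) (h' : IsGenerated d')
    {H : unitInterval → X → Y} {Θ : unitInterval → A → B}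
    (hΘ : Continuous fun q : unitInterval × A => Θ q.1 q.2)
    (hH : ∀ t x, IsPush (Θ t) (d x) (d' (H t x))) :
    KContinuous fun q : unitInterval × X => H q.1 q.2 :=
  h Y H fun K _ _ _ F hF => h'.continuous_of_isTest (unitInterval × K) _
    ((hF.comp continuous_snd).push (Θ := fun q => Θ q.1)
      (hΘ.comp (f := fun y : (unitInterval × K) × A => (y.1.1, y.2)) (by fun_prop))
      fun q => hH q.1 (F q.2))

theorem IsKGenerated.kContinuous [TopologicalSpace X] [TopologicalSpace Y]
    {d : X → Config A M} {d' : Y → Config B M} (h : IsKGenerated d) (h' : IsGenerated d')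
    {f : X → Y} {θ : A → B} (hθ : Continuous θ) (hf : ∀ x, IsPush θ (d x) (d' (f x))) :
    KContinuous f := by
  intro K _ _ _ c hc
  exact h.kContinuous_homotopy h' (H := fun _ => f) (Θ := fun _ => θ) (hθ.comp continuous_snd)
    (fun _ => hf) K (fun k => (0, c k)) (by fun_prop)

end Generated

/-! ### Homotopies that move the particles -/

section Homotopy

variable {G : Type w} [Group G] {A B : Type u} {M : Type v} [PartialMonoid M] [MulAction G A]
  [MulAction G B] [SMulZeroClass G M] {X Y : Type max u v} [Zero X] [Zero Y] [SMul G X] [SMul G Y]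

/-- The points of `X` are equivariantly the configurations of a certain kind. -/
structure IsEquivariantMap (G : Type w) [Group G] [MulAction G A] [SMulZeroClass G M] [Zero X]
    [SMul G X] (d : X → Config A M) : Prop where
  injective : Function.Injective d
  map_smul : ∀ (g : G) x, d (g • x) = g • d x
  map_zero : d 0 = 0

/-- `θ` moves the particles of the configurations in `X` to configurations in `Y`. -/
def Moves (G : Type w) [SMul G A] [SMul G B] (d : X → Config A M) (d' : Y → Config B M)
    (θ : A → B) : Prop :=
  (∀ (g : G) a, θ (g • a) = g • θ a) ∧ ∀ x, ∃ y, IsPush θ (d x) (d' y)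

variable {d : X → Config A M} {d' : Y → Config B M}

/-- Both sides are the result of moving `g • d x` along the equivariant map `θ`. The action must not
send non-zero labels to `0`, as otherwise it would lose points of a configuration. -/
theorem smul_eq_of_isPush (hM : ∀ (g : G) (a : M), g • a = 0 → a = 0)
    (hd : IsEquivariantMap G d) (hd' : IsEquivariantMap G d') {θ : A → B}
    (hθ : ∀ (g : G) a, θ (g • a) = g • θ a) {f : X → Y} (hf : ∀ x, IsPush θ (d x) (d' (f x)))
    (g : G) (x : X) : f (g • x) = g • f x := by
  apply hd'.injective
  have h1 := hf (g • x)
  rw [hd.map_smul] at h1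
  rw [hd'.map_smul]
  exact h1.unique ((hf x).smul g (hM g) hθ)

theorem zero_eq_of_isPush (hd : IsEquivariantMap G d) (hd' : IsEquivariantMap G d') {θ : A → B}
    {f : X → Y} (hf : ∀ x, IsPush θ (d x) (d' (f x))) : f 0 = 0 := by
  apply hd'.injective
  have h1 := hf 0
  rw [hd.map_zero] at h1
  rw [hd'.map_zero]
  exact h1.unique (IsPush.zero θ)

variable [TopologicalSpace A] [TopologicalSpace B] [TopologicalSpace M] [TopologicalSpace X]
  [TopologicalSpace Y]

theorem isPointedGMap_of_isPush (hM : ∀ (g : G) (a : M), g • a = 0 → a = 0)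
    (hd : IsEquivariantMap G d) (hd' : IsEquivariantMap G d') (h : IsGenerated d)
    (h' : IsGenerated d') {θ : A → B} (hc : Continuous θ)
    (hθ : ∀ (g : G) a, θ (g • a) = g • θ a) {f : X → Y} (hf : ∀ x, IsPush θ (d x) (d' (f x))) :
    IsPointedGMap G f :=
  ⟨h.continuous_of_isPush h' hc hf, smul_eq_of_isPush hM hd hd' hθ hf,
    zero_eq_of_isPush hd hd' hf⟩

/-! ### Homotopies of maps of positions -/

/-- The maps `f` and `g` are homotopic through maps with the property `P`. -/
def HomotopicThrough {A B : Type*} [TopologicalSpace A] [TopologicalSpace B] (P : (A → B) → Prop)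
    (f g : A → B) : Prop :=
  ∃ Θ : unitInterval → A → B, (Continuous fun q : unitInterval × A => Θ q.1 q.2) ∧
    Θ 0 = f ∧ Θ 1 = g ∧ ∀ t, P (Θ t)

namespace HomotopicThrough

variable {A B : Type*} [TopologicalSpace A] [TopologicalSpace B] {P : (A → B) → Prop}
  {f g k : A → B}

theorem nonempty_homotopyWith (h : HomotopicThrough P f g) :
    ∃ (f' g' : C(A, B)), ⇑f' = f ∧ ⇑g' = g ∧
      Nonempty (ContinuousMap.HomotopyWith f' g' fun θ => P θ) := by
  obtain ⟨Θ, hΘ, rfl, rfl, hP⟩ := h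
  exact ⟨⟨Θ 0, hΘ.comp (f := fun a => (0, a)) (by fun_prop)⟩,
    ⟨Θ 1, hΘ.comp (f := fun a => (1, a)) (by fun_prop)⟩, rfl, rfl,
    ⟨⟨⟨⟨_, hΘ⟩, fun _ => rfl, fun _ => rfl⟩, hP⟩⟩⟩

theorem of_homotopyWith {f g : C(A, B)} (Θ : ContinuousMap.HomotopyWith f g fun θ => P θ) :
    HomotopicThrough P f g :=
  ⟨fun t a => Θ (t, a), Θ.continuous, funext Θ.apply_zero, funext Θ.apply_one, Θ.prop'⟩

theorem symm (h : HomotopicThrough P f g) : HomotopicThrough P g f := by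
  obtain ⟨f', g', rfl, rfl, ⟨Θ⟩⟩ := h.nonempty_homotopyWith
  exact of_homotopyWith Θ.symm

theorem trans (h : HomotopicThrough P f g) (h' : HomotopicThrough P g k) :
    HomotopicThrough P f k := by
  obtain ⟨f', g', rfl, rfl, ⟨Θ⟩⟩ := h.nonempty_homotopyWith
  obtain ⟨g'', k', hg, rfl, ⟨Θ'⟩⟩ := h'.nonempty_homotopyWith
  obtain rfl := DFunLike.coe_injective hg
  exact of_homotopyWith (Θ.trans Θ')

end HomotopicThrough

/-- The values of the homotopy are chosen separately for each `t` and `x`. As they are unique, the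
end maps, equivariance and the base point take care of themselves, and continuity only depends on
that of `Θ`. -/
theorem gHomotopic_of_isPush (hM : ∀ (g : G) (a : M), g • a = 0 → a = 0)
    (hd : IsEquivariantMap G d) (hd' : IsEquivariantMap G d') (h : IsKGenerated d)
    (h' : IsGenerated d') {θ₀ θ₁ : A → B} (hΘ : HomotopicThrough (Moves G d d') θ₀ θ₁)
    {f₀ f₁ : X → Y} (h₀ : ∀ x, IsPush θ₀ (d x) (d' (f₀ x)))
    (h₁ : ∀ x, IsPush θ₁ (d x) (d' (f₁ x))) : GHomotopic G f₀ f₁ := by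
  obtain ⟨Θ, hc, rfl, rfl, hm⟩ := hΘ
  choose H hH using fun t => (hm t).2
  exact ⟨H, h.kContinuous_homotopy h' hc hH, fun x => hd'.injective ((hH 0 x).unique (h₀ x)),
    fun x => hd'.injective ((hH 1 x).unique (h₁ x)),
    fun t => smul_eq_of_isPush hM hd hd' (hm t).1 (hH t),
    fun t => zero_eq_of_isPush hd hd' (hH t)⟩

end Homotopy

/-! ### The topology of `I(ℝ)₊` -/

/-- The space of closed intervals of positive length. -/
abbrev Strand : Type := {J : ℝ × ℝ // J.1 < J.2}

/-- Intervals do not degenerate inside `I(ℝ)₊`, so `φ` may blow up as the length tends to `0`. This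
is used for the inverse of the length. -/
theorem IPlus.continuous_sum {φ : ℝ × ℝ → ℝ} (hφ : ContinuousOn φ {J | J.1 < J.2}) :
    Continuous fun P : IPlus => ∑ J ∈ P.intervals, φ J := by
  classical
  refine continuous_iSup_dom.2 fun r => continuous_coinduced_dom.2 ?_
  have : (fun P : IPlus => ∑ J ∈ P.intervals, φ J) ∘ IntervalTuple.union (r := r) =
      fun x => ∑ i, φ (x.1 i) := by
    funext x
    -- Disjoint non-empty intervals are different, so passing to the set of intervals identifies no
    -- two indices.
    refine Finset.sum_image fun i _ j _ h => ?_
    by_contra hij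
    have hx := x.2.2 hij
    have hm : (x.1 i).1 ∈ Icc (x.1 i).1 (x.1 i).2 := ⟨le_rfl, (x.2.1 i).le⟩
    exact Set.disjoint_left.1 hx hm (h ▸ hm)
  rw [this]
  refine continuous_finsetSum _ fun i _ => hφ.comp_continuous ?_ fun x => x.2.1 i
  exact (continuous_apply i).comp continuous_subtype_val

/-- A Urysohn function that is `1` at `J` and `0` at the other members of both multisets counts the
multiplicity of `J`. -/
theorem eq_of_forall_sum_eq {X : Type*} [TopologicalSpace X] [T4Space X] {s t : Multiset X}
    (h : ∀ φ : C(X, ℝ), (s.map φ).sum = (t.map φ).sum) : s = t := by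
  classical
  refine Multiset.ext.2 fun J => ?_
  have hF : IsClosed (((s + t).toFinset.erase J : Finset X) : Set X) :=
    (Finset.finite_toSet _).isClosed
  obtain ⟨φ, h0, h1, -⟩ := exists_continuous_zero_one_of_isClosed hF (isClosed_singleton (x := J))
    (Set.disjoint_singleton_right.2 (by simp))
  have h1 : φ J = 1 := h1 rfl
  have key : ∀ u : Multiset X, u ≤ s + t → (u.map φ).sum = u.count J := by
    intro u
    induction u using Multiset.induction_on with
    | empty => simp
    | cons a u ih =>
      intro hu
      rw [Multiset.map_cons, Multiset.sum_cons, ih ((Multiset.le_cons_self u a).trans hu)]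
      by_cases ha : a = J
      · subst ha
        rw [h1, Multiset.count_cons_self]
        push_cast
        ring
      · have : φ a = 0 := h0 (by
          simp only [Finset.coe_erase, mem_sdiff, mem_singleton_iff]
          exact ⟨Multiset.mem_toFinset.2
            (Multiset.mem_of_le hu (Multiset.mem_cons_self a u)), ha⟩)
        rw [this, Multiset.count_cons_of_ne (Ne.symm ha), zero_add]
  have h2 := h φ
  rw [key s (Multiset.le_add_right s t), key t (Multiset.le_add_left t s)] at h2
  exact_mod_cast h2

instance : T1Space IPlus := by
  have hc : Continuous fun (P : IPlus) (φ : C(ℝ × ℝ, ℝ)) => ∑ J ∈ P.intervals, φ J :=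
    continuous_pi fun φ => IPlus.continuous_sum φ.continuous.continuousOn
  have hi : Function.Injective fun (P : IPlus) (φ : C(ℝ × ℝ, ℝ)) => ∑ J ∈ P.intervals, φ J :=
    fun P Q h => IPlus.ext (Finset.val_injective (eq_of_forall_sum_eq fun φ => congrFun h φ))
  have := T2Space.of_injective_continuous hi hc
  infer_instance

theorem IPlus.eq_zero_iff {P : IPlus} : P = 0 ↔ P.intervals = ∅ :=
  ⟨fun h => h ▸ rfl, fun h => IPlus.ext h⟩

theorem IPlus.isClopen_zero : IsClopen {P : IPlus | P = 0} := by
  refine ⟨isClosed_singleton, ?_⟩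
  have hc : Continuous fun P : IPlus => ∑ J ∈ P.intervals, (1 : ℝ) :=
    IPlus.continuous_sum continuousOn_const
  convert (isOpen_Iio (a := (1 : ℝ))).preimage hc using 1
  ext P
  simp [IPlus.eq_zero_iff]

/-- The union of a single interval. -/
def Strand.toIPlus (J : Strand) : IPlus where
  intervals := {J.1}
  lt := by simpa using J.2
  disj := by simp

theorem Strand.continuous_toIPlus : Continuous Strand.toIPlus := by
  have h1 : Continuous (IntervalTuple.union (r := 1)) :=
    continuous_iSup_rng (i := 1) continuous_coinduced_rng
  have h2 : Continuous fun J : Strand => (⟨fun _ => J.1, fun _ => J.2, fun i j hij =>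
      absurd (Subsingleton.elim i j) hij⟩ : IntervalTuple 1) :=
    Continuous.subtype_mk (continuous_pi fun _ => continuous_subtype_val) _
  convert h1.comp h2 using 1
  funext J
  refine IPlus.ext ?_
  classical
  change {J.1} = Finset.univ.image fun _ : Fin 1 => J.1
  simp

/-! ### Points of `I(ℝ)₊ ∧ M` -/

section Smash

variable {M : Type v}

theorem Smash.exists_mk [Zero M] (z : Smash IPlus M) : ∃ P a, z = Smash.mk P a := by
  induction z using Quotient.inductionOn with | h p => exact ⟨p.1, p.2, rfl⟩

theorem strings_zero [Zero M] : strings (0 : Smash IPlus M) = ∅ := by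
  classical
  change strings (Smash.mk (0 : IPlus) (0 : M)) = ∅
  simp [strings_mk]

theorem strings_subset [Zero M] (P : IPlus) (a : M) : strings (Smash.mk P a) ⊆ P.intervals := by
  classical
  rw [strings_mk]
  split_ifs <;> simp

theorem strings_eq_of_label_ne [Zero M] {P : IPlus} {a : M} (h : label (Smash.mk P a) ≠ 0) :
    P ≠ 0 ∧ label (Smash.mk P a) = a ∧ a ≠ 0 ∧ strings (Smash.mk P a) = P.intervals := by
  classical
  rw [label_mk] at h ⊢
  rw [strings_mk]
  by_cases hP : P = 0
  · simp [hP] at h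
  · rw [if_neg hP] at h ⊢
    exact ⟨hP, rfl, h, if_neg h⟩

theorem label_ne_zero [Zero M] {z : Smash IPlus M} {J : ℝ × ℝ} (h : J ∈ strings z) :
    label z ≠ 0 := by
  classical
  obtain ⟨P, a, rfl⟩ := z.exists_mk
  rw [strings_mk] at h
  split_ifs at h with ha
  · simp at h
  · rwa [label_mk, if_neg (IPlus.ne_zero_of_mem h)]

theorem strings_lt [Zero M] {z : Smash IPlus M} {J : ℝ × ℝ} (h : J ∈ strings z) : J.1 < J.2 := by
  obtain ⟨P, a, rfl⟩ := z.exists_mk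
  exact P.lt J (strings_subset P a h)

theorem strings_disjoint [Zero M] {z : Smash IPlus M} {J J' : ℝ × ℝ} (h : J ∈ strings z)
    (h' : J' ∈ strings z) (hne : J ≠ J') : Disjoint (Icc J.1 J.2) (Icc J'.1 J'.2) := by
  obtain ⟨P, a, rfl⟩ := z.exists_mk
  exact P.disj (strings_subset P a h) (strings_subset P a h') hne

/-- The union of the strings of a point of `I(ℝ)₊ ∧ M`. -/
noncomputable def stringUnion [Zero M] (z : Smash IPlus M) : IPlus where
  intervals := strings z
  lt _ h := strings_lt h
  disj _ h _ h' hne := strings_disjoint h h' hne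

theorem mk_stringUnion_label [Zero M] (z : Smash IPlus M) :
    Smash.mk (stringUnion z) (label z) = z := by
  by_cases h : label z = 0
  · rw [Smash.mk_eq_zero (Or.inr h)]
    obtain ⟨P, a, rfl⟩ := z.exists_mk
    classical
    rw [label_mk] at h
    split_ifs at h with hP
    · rw [Smash.mk_eq_zero (Or.inl hP)]
    · rw [Smash.mk_eq_zero (Or.inr h)]
  · obtain ⟨P, a, rfl⟩ := z.exists_mk
    obtain ⟨-, h1, -, h2⟩ := strings_eq_of_label_ne h
    rw [h1, show stringUnion (Smash.mk P a) = P from IPlus.ext h2]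

variable [TopologicalSpace M]

theorem continuous_smashMk [Zero M] :
    Continuous fun y : IPlus × M => (Smash.mk y.1 y.2 : Smash IPlus M) :=
  continuous_quotient_mk'

theorem isOpen_smash_iff [Zero M] {W : Set (Smash IPlus M)} :
    IsOpen W ↔ IsOpen {y : IPlus × M | Smash.mk y.1 y.2 ∈ W} := Iff.rfl

/-- The case distinction does no harm because the empty union is an isolated point of `I(ℝ)₊`. -/
theorem continuous_label [Zero M] : Continuous (label : Smash IPlus M → M) := by
  classical
  have : Continuous fun q : IPlus × M => if q.1 = 0 then (0 : M) else q.2 := by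
    refine Continuous.if (fun a ha => ?_) continuous_const continuous_snd
    have h := (IPlus.isClopen_zero.preimage (continuous_fst (X := IPlus) (Y := M))).frontier_eq
    have ha' : a ∈ frontier (Prod.fst ⁻¹' {P : IPlus | P = 0}) := ha
    rw [h] at ha'
    exact absurd ha' (notMem_empty a)
  exact this.quotient_lift _

variable [T1Space M]

theorem isOpen_label_ne [Zero M] : IsOpen {z : Smash IPlus M | label z ≠ 0} :=
  isOpen_compl_singleton.preimage continuous_label

/-- Where the label is non-zero, `P ∧ a` determines `P`, and the smash product looks like an open
part of `I(ℝ)₊ × M`. At the base point continuity can fail, since strings vanish there with their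
label. -/
theorem continuousOn_sum_strings [Zero M] {φ : ℝ × ℝ → ℝ} (hφ : ContinuousOn φ {J | J.1 < J.2}) :
    ContinuousOn (fun z : Smash IPlus M => ∑ J ∈ strings z, φ J) {z | label z ≠ 0} := by
  rw [continuousOn_open_iff isOpen_label_ne]
  intro t ht
  rw [isOpen_smash_iff]
  have h1 : IsOpen {y : IPlus × M | label (Smash.mk y.1 y.2) ≠ 0} :=
    isOpen_label_ne.preimage continuous_smashMk
  have h2 := ht.preimage ((IPlus.continuous_sum hφ).comp (continuous_fst (Y := M)))
  convert h1.inter h2 using 1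
  ext ⟨P, a⟩
  refine and_congr_right fun h => ?_
  have h : label (Smash.mk P a) ≠ 0 := h
  simp [(strings_eq_of_label_ne h).2.2.2]

/-- A positive continuous function of the strings of a point of `I(ℝ)₊ ∧ M` is bounded on compact
sets, away from the base point. -/
theorem exists_sum_strings_le [Zero M] {K : Type*} [TopologicalSpace K] [CompactSpace K]
    {x : K → Smash IPlus M} (hx : Continuous x) {φ : ℝ × ℝ → ℝ}
    (hφ : ContinuousOn φ {J | J.1 < J.2}) :
    ∃ c : ℝ, ∀ k, label (x k) ≠ 0 → ∑ J ∈ strings (x k), φ J ≤ c := by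
  by_contra! hcon
  choose κ hκ hκ' using fun m : ℕ => hcon m
  -- If the sums are unbounded, there is a sequence of points away from the base point whose sums
  -- tend to infinity. Its tails turn out to be closed, which compactness of `K` forbids.
  choose P a hPa using fun m => (x (κ m)).exists_mk
  have hs : ∀ m, strings (x (κ m)) = (P m).intervals ∧ label (x (κ m)) = a m := fun m => by
    have h := hκ m
    rw [hPa] at h ⊢
    exact ⟨(strings_eq_of_label_ne h).2.2.2, (strings_eq_of_label_ne h).2.1⟩
  let b : IPlus → ℝ := fun P => ∑ J ∈ P.intervals, φ J
  have hb : Continuous b := IPlus.continuous_sum hφ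
  have hbP : ∀ m : ℕ, (m : ℝ) < b (P m) := fun m => by
    have := hκ' m
    rwa [(hs m).1] at this
  let W : ℕ → Set (Smash IPlus M) := fun m => {z | ∀ j, m ≤ j → z ≠ x (κ j)}
  -- Near a given point of `I(ℝ)₊ × M` the continuous function `b` is bounded, which leaves only
  -- finitely many indices.
  have hlf : LocallyFinite fun j : ℕ => ({(P j, a j)} : Set (IPlus × M)) := by
    intro y
    refine ⟨{y' | b y'.1 < b y.1 + 1}, (isOpen_Iio.preimage (hb.comp continuous_fst)).mem_nhds
      (by simp), (Set.finite_Iio (⌈b y.1 + 1⌉₊)).subset ?_⟩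
    rintro j ⟨y', hy', hy''⟩
    rw [mem_singleton_iff] at hy'
    subst hy'
    have h1 : (j : ℝ) < b y.1 + 1 := (hbP j).trans hy''
    exact_mod_cast h1.trans_le (Nat.le_ceil _)
  have hW : ∀ m, IsOpen (W m) := by
    intro m
    rw [isOpen_smash_iff, ← isClosed_compl_iff]
    have hlf' : LocallyFinite fun j : {j : ℕ // m ≤ j} => ({(P j, a j)} : Set (IPlus × M)) :=
      hlf.comp_injective Subtype.val_injective
    convert hlf'.isClosed_iUnion fun j => isClosed_singleton using 1
    ext ⟨Q, c⟩
    simp only [W, mem_compl_iff, mem_ofPred_eq, not_forall, mem_iUnion, mem_singleton_iff,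
      Prod.mk.injEq, Subtype.exists, not_not]
    -- The tail avoids the base point, so its preimage in `I(ℝ)₊ × M` consists of single points. As
    -- points are closed, local finiteness makes it closed.
    refine exists_congr fun j => exists_congr fun _ => ⟨fun h => ?_, fun h => ?_⟩
    · have h1 := hκ j
      rw [← h] at h1
      obtain ⟨-, h2, -, h3⟩ := strings_eq_of_label_ne h1
      rw [h, (hs j).1] at h3
      rw [h, (hs j).2] at h2
      exact ⟨(IPlus.ext h3).symm, h2.symm⟩
    · rw [h.1, h.2, hPa]
  have hcov : (univ : Set K) ⊆ ⋃ m, x ⁻¹' W m := by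
    intro k _
    obtain ⟨m, hm⟩ := exists_nat_ge (∑ J ∈ strings (x k), φ J)
    refine mem_iUnion.2 ⟨m, fun j hj h => ?_⟩
    rw [h] at hm
    have h1 := hκ' j
    have h2 : (m : ℝ) ≤ j := by exact_mod_cast hj
    linarith
  -- The sets `W m` increase with `m`, so a single one covers; but `x (κ m)` is not in `W m`.
  obtain ⟨m, hm⟩ := isCompact_univ.elim_directed_cover _ (fun m => (hW m).preimage hx) hcov
    (directed_of_isDirected_le fun i j hij k hk l hl => hk l (hij.trans hl))
  exact hm (mem_univ (κ m)) m le_rfl rfl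

end Smash

/-! ### The strings of a configuration -/

section Strands

variable {V : Type u} {M : Type v}

open Classical in
/-- The configuration of the strings in `f`, as points of `V × Strand` with labels in `M`. -/
noncomputable def strands [PartialMonoid M] (f : StringConfig V M) : Config (V × Strand) M :=
  Finsupp.onFinset
    (f.labels.support.biUnion fun x =>
      ((strings (f.labels x)).subtype fun J => J.1 < J.2).image fun J => (x, J))
    (fun e => if e.2.1 ∈ strings (f.labels e.1) then label (f.labels e.1) else 0)
    (by
      rintro ⟨x, J⟩ he
      split_ifs at he with h
      · refine Finset.mem_biUnion.2 ⟨x, Finsupp.mem_support_iff.2 fun h0 => ?_,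
          Finset.mem_image.2 ⟨J, Finset.mem_subtype.2 h, rfl⟩⟩
        change J.1 ∈ strings (f.labels x) at h
        rw [h0, strings_zero] at h
        exact absurd h (Finset.notMem_empty _)
      · exact absurd rfl he)

variable [PartialMonoid M]

open Classical in
theorem strands_labels (f : StringConfig V M) (e : V × Strand) : (strands f).labels e =
    if e.2.1 ∈ strings (f.labels e.1) then label (f.labels e.1) else 0 := rfl

theorem strands_ne_zero {f : StringConfig V M} {e : V × Strand} :
    (strands f).labels e ≠ 0 ↔ e.2.1 ∈ strings (f.labels e.1) := by
  classical
  rw [strands_labels]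
  by_cases h : e.2.1 ∈ strings (f.labels e.1)
  · simp [h, label_ne_zero h]
  · simp [h]

theorem strands_apply {f : StringConfig V M} {e : V × Strand}
    (h : e.2.1 ∈ strings (f.labels e.1)) :
    (strands f).labels e = label (f.labels e.1) := by
  classical
  rw [strands_labels, if_pos h]

/-- The label of a point can be recovered only from a string over it; without strings, the point
carries the base point. -/
theorem strands_injective : Function.Injective (strands : StringConfig V M → _) := by
  intro f f' h
  refine Config.ext fun z => ?_
  have h1 : strings (f.labels z) = strings (f'.labels z) := by
    ext J
    constructor
    · intro hJ
      rwa [← strands_ne_zero (e := (z, ⟨J, strings_lt hJ⟩)), h, strands_ne_zero] at hJ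
    · intro hJ
      rwa [← strands_ne_zero (e := (z, ⟨J, strings_lt hJ⟩)), ← h, strands_ne_zero] at hJ
  by_cases h0 : (strings (f.labels z)).Nonempty
  · obtain ⟨J, hJ⟩ := h0
    have h2 : label (f.labels z) = label (f'.labels z) := by
      rw [← strands_apply (e := (z, ⟨J, strings_lt hJ⟩)) hJ, h,
        strands_apply (e := (z, ⟨J, strings_lt hJ⟩)) (h1 ▸ hJ)]
    rw [← mk_stringUnion_label (f.labels z), ← mk_stringUnion_label (f'.labels z), h2]
    congr 1
    exact IPlus.ext h1
  · have key : ∀ f : StringConfig V M, strings (f.labels z) = ∅ → f.labels z = 0 := by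
      intro f hf
      rw [← mk_stringUnion_label (f.labels z)]
      exact Smash.mk_eq_zero (Or.inl (IPlus.ext hf))
    rw [Finset.not_nonempty_iff_eq_empty] at h0
    rw [key f h0, key f' (h1 ▸ h0)]

theorem strands_zero : strands (0 : StringConfig V M) = 0 := by
  refine Config.ext fun e => ?_
  by_contra h
  have := strands_ne_zero.1 h
  rw [show (0 : StringConfig V M).labels e.1 = 0 from rfl, strings_zero] at this
  exact Finset.notMem_empty _ this

/-- The conditions on the strings of a configuration: strings over the same point have the same
label, and they are disjoint. -/
def AreStrands (g : Config (V × Strand) M) : Prop :=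
  ∀ (x : V) (J J' : Strand), g.labels (x, J) ≠ 0 → g.labels (x, J') ≠ 0 →
    g.labels (x, J) = g.labels (x, J') ∧ (J ≠ J' → Disjoint (Icc J.1.1 J.1.2) (Icc J'.1.1 J'.1.2))

theorem areStrands_strands (f : StringConfig V M) : AreStrands (strands f) := by
  intro x J J' h h'
  rw [strands_ne_zero] at h h'
  refine ⟨?_, fun hne => strings_disjoint h h' fun h0 => hne (Subtype.ext h0)⟩
  rw [strands_apply h, strands_apply h']

theorem AreStrands.exists_eq {g : Config (V × Strand) M} (h : AreStrands g) :
    ∃ f : StringConfig V M, strands f = g := by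
  classical
  let E : V → Finset (V × Strand) := fun x => g.labels.support.filter fun e => e.1 = x
  have hE : ∀ {x : V} {J : ℝ × ℝ}, J ∈ (E x).image (fun e => e.2.1) ↔
      ∃ hJ : J.1 < J.2, g.labels (x, ⟨J, hJ⟩) ≠ 0 := by
    intro x J
    simp only [E, Finset.mem_image, Finset.mem_filter, Finsupp.mem_support_iff]
    constructor
    · rintro ⟨⟨x, J⟩, ⟨h1, rfl⟩, rfl⟩
      exact ⟨J.2, h1⟩
    · rintro ⟨hJ, h1⟩
      exact ⟨(x, ⟨J, hJ⟩), ⟨h1, rfl⟩, rfl⟩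
  let P : V → IPlus := fun x =>
    { intervals := (E x).image fun e => e.2.1
      lt := fun J hJ => (hE.1 hJ).1
      disj := by
        intro J hJ J' hJ' hne
        obtain ⟨h1, h2⟩ := hE.1 (Finset.mem_coe.1 hJ)
        obtain ⟨h1', h2'⟩ := hE.1 (Finset.mem_coe.1 hJ')
        exact (h x _ _ h2 h2').2 fun h0 => hne (congrArg Subtype.val h0) }
  -- Any string over `x` may supply the label, since the strings over `x` have the same one.
  let b : V → M := fun x => if hx : ∃ J, g.labels (x, J) ≠ 0 then g.labels (x, hx.choose) else 0
  have hb : ∀ {x : V} {J : Strand}, g.labels (x, J) ≠ 0 → b x = g.labels (x, J) := by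
    intro x J hJ
    have hx : ∃ J, g.labels (x, J) ≠ 0 := ⟨J, hJ⟩
    rw [show b x = g.labels (x, hx.choose) from dif_pos hx]
    exact (h x _ _ hx.choose_spec hJ).1
  let f : StringConfig V M := (Finsupp.onFinset (g.labels.support.image Prod.fst)
    (fun x => Smash.mk (P x) (b x)) (by
      intro x hx
      by_contra h0
      refine hx (Smash.mk_eq_zero (Or.inr (dif_neg ?_)))
      rintro ⟨J, hJ⟩
      exact h0 (Finset.mem_image.2 ⟨(x, J), Finsupp.mem_support_iff.2 hJ, rfl⟩)) :
        V →₀ Smash IPlus M)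
  have hf : ∀ x, f.labels x = Smash.mk (P x) (b x) := fun x => rfl
  refine ⟨f, Config.ext ?_⟩
  rintro ⟨x, J⟩
  by_cases hJ : g.labels (x, J) = 0
  · rw [hJ]
    by_contra h0
    rw [← ne_eq, strands_ne_zero, hf] at h0
    exact (hE.1 (strings_subset _ _ h0)).2 hJ
  · have hmem : J.1 ∈ (P x).intervals := hE.2 ⟨J.2, hJ⟩
    have hs : J.1 ∈ strings (f.labels x) := by
      rw [hf, strings_mk, if_neg (by rwa [hb hJ])]
      exact hmem
    rw [strands_apply hs, hf, label_mk, if_neg (IPlus.ne_zero_of_mem hmem), hb hJ]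

theorem strands_smul {G : Type*} [Group G] [MulAction G V] [SMulZeroClass G M]
    (hM : ∀ (g : G) (a : M), g • a = 0 → a = 0) (g : G) (f : StringConfig V M)
    {act : MulAction G (V × Strand)} (hact : ∀ e : V × Strand, g⁻¹ • e = (g⁻¹ • e.1, e.2)) :
    strands (g • f) = g • strands f := by
  classical
  refine Config.ext fun e => ?_
  rw [Config.labels_smul, strands_labels, strands_labels, Config.labels_smul, hact]
  generalize f.labels (g⁻¹ • e.1) = z
  obtain ⟨P, a, rfl⟩ := z.exists_mk
  rw [show g • Smash.mk P a = Smash.mk P (g • a) from rfl]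
  have h0 : g • a = 0 ↔ a = 0 := ⟨hM g a, fun h => by rw [h, smul_zero]⟩
  simp only [strings_mk, label_mk, h0]
  by_cases ha : a = 0
  · simp [ha]
  · simp only [ha, if_false]
    split_ifs <;> simp

/-! ### Superposition of strings -/

/-- A family of strings with labels, as a family of particles with labels in `I(ℝ)₊ ∧ M`. -/
def asString (y : (V × Strand) × M) : V × Smash IPlus M := (y.1.1, Smash.mk y.1.2.toIPlus y.2)

theorem interchangeable_smash_iff {s : Multiset (Smash IPlus M)} {z : Smash IPlus M} :
    Interchangeable s {z} ↔ addConGen (Distrib IPlus M) s {z} :=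
  interchangeable_singleton_iff

theorem sum_map_singleton_apply {α β : Type*} (s : Multiset α) (φ : α → β) :
    (s.map fun a => ({φ a} : Multiset β)).sum = s.map φ := by
  rw [← Multiset.sum_map_singleton (s.map φ), Multiset.map_map]
  rfl

theorem labelsOver_asString (s : Multiset ((V × Strand) × M)) (x : V) (E : Finset Strand)
    (hE : ∀ y ∈ s, y.1.1 = x → y.1.2 ∈ E) :
    labelsOver (s.map asString) x =
      ∑ J ∈ E, (labelsOver s (x, J)).map (Smash.mk J.toIPlus) := by
  classical
  induction s using Multiset.induction_on with
  | empty => simp [labelsOver_zero]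
  | cons y s ih =>
    rw [Multiset.map_cons, labelsOver_cons, ih fun y hy => hE y (Multiset.mem_cons_of_mem hy)]
    simp only [labelsOver_cons, Multiset.map_add, Finset.sum_add_distrib]
    congr 1
    have := hE y (Multiset.mem_cons_self y s)
    obtain ⟨⟨x', J⟩, a⟩ := y
    by_cases h : x' = x
    · subst h
      have h2 : ∀ J' : Strand, Multiset.map (Smash.mk J'.toIPlus)
          (if (x', J) = (x', J') then {a} else 0) =
          if J = J' then {Smash.mk J.toIPlus a} else 0 := by
        intro J'
        by_cases hJ : J = J' <;> simp [hJ]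
      simp only [h2, Finset.sum_ite_eq, if_pos (this rfl), asString, if_true]
    · simp [asString, h]

/-- Over a point `x`, distributivity on the right adds up the labels of particles with the same
interval. The strings that remain are disjoint and share a label, so distributivity on the left
unites them. Intervals whose labels add up to `0` disappear in the first step and need not be
disjoint from the others. -/
theorem Represents.asString {s : Multiset ((V × Strand) × M)} {f : StringConfig V M}
    (h : Represents s (strands f)) : Represents (s.map asString) f := by
  classical
  intro x
  let T : Finset Strand := (strings (f.labels x)).subtype fun J => J.1 < J.2
  have hT : ∀ J : Strand, J ∈ T ↔ J.1 ∈ strings (f.labels x) := fun J => Finset.mem_subtype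
  let E : Finset Strand := (s.map fun y => y.1.2).toFinset ∪ T
  rw [labelsOver_asString s x E fun y hy _ => Finset.mem_union_left _
    (Multiset.mem_toFinset.2 (Multiset.mem_map_of_mem _ hy))]
  have h1 : Interchangeable (∑ J ∈ E, (labelsOver s (x, J)).map (Smash.mk J.toIPlus))
      (∑ J ∈ E, if J ∈ T then {Smash.mk J.toIPlus (label (f.labels x))} else 0) := by
    refine Interchangeable.finset_sum E fun J _ => ?_
    have h2 : Interchangeable ((labelsOver s (x, J)).map (Smash.mk J.toIPlus))
        {Smash.mk J.toIPlus ((strands f).labels (x, J))} :=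
      interchangeable_smash_iff.2 (AddConGen.Rel.of _ _
        (Distrib.right _ _ _ (interchangeable_singleton_iff.1 (h (x, J)))))
    by_cases hJ : J ∈ T
    · rw [if_pos hJ]
      rwa [strands_apply ((hT J).1 hJ)] at h2
    · rw [if_neg hJ]
      have h3 : (strands f).labels (x, J) = 0 := by
        by_contra h0
        exact hJ ((hT J).2 (strands_ne_zero.1 h0))
      rw [h3, Smash.mk_eq_zero (Or.inr rfl)] at h2
      exact h2.trans zero_interchangeable.symm
  refine h1.trans ?_
  rw [Finset.sum_ite_mem, Finset.inter_eq_right.2 Finset.subset_union_right]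
  conv_rhs => rw [← mk_stringUnion_label (f.labels x)]
  rw [interchangeable_smash_iff]
  have h4 : (∑ J ∈ T, {Smash.mk J.toIPlus (label (f.labels x))} : Multiset (Smash IPlus M)) =
      (T.val.map Strand.toIPlus).map fun P => Smash.mk P (label (f.labels x)) := by
    rw [Multiset.map_map, Finset.sum_eq_multiset_sum]
    exact sum_map_singleton_apply T.val _
  rw [h4]
  refine AddConGen.Rel.of _ _ (Distrib.left _ _ _ ?_)
  change ((T.val.map Strand.toIPlus).map IPlus.components).sum = (strings (f.labels x)).val
  have h5 : T.map (Function.Embedding.subtype _) = strings (f.labels x) := by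
    rw [Finset.subtype_map, Finset.filter_true_of_mem fun J hJ => strings_lt hJ]
  rw [← h5, Finset.map_val, Multiset.map_map]
  exact sum_map_singleton_apply T.val _

end Strands

/-! ### The topology of the space of strings -/

section StrandTopology

variable {V : Type u} {M : Type v}

open Classical in
theorem labelsOver_univ_map {A : Type*} {ι : Type*} [Fintype ι] (g : ι → A × M) (z : A) :
    labelsOver (Finset.univ.val.map g) z = ∑ i, if (g i).1 = z then {(g i).2} else 0 := by
  have key : ∀ s : Multiset ι, labelsOver (s.map g) z =
      (s.map fun i => if (g i).1 = z then ({(g i).2} : Multiset M) else 0).sum := by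
    intro s
    induction s using Multiset.induction_on with
    | empty => simp [labelsOver_zero]
    | cons i s ih => rw [Multiset.map_cons, labelsOver_cons, ih, Multiset.map_cons,
        Multiset.sum_cons]
  exact key _

theorem labelsAt_sum [Zero M] {ι : Type*} (E : Finset ι) (J : ℝ × ℝ)
    (S : ι → Multiset (Smash IPlus M)) :
    labelsAt J (∑ i ∈ E, S i) = ∑ i ∈ E, labelsAt J (S i) := by
  let φ : Multiset (Smash IPlus M) →+ Multiset M := ⟨⟨labelsAt J, labelsAt_zero J⟩, labelsAt_add J⟩
  exact map_sum φ S E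

/-- If particles with labels in `I(ℝ)₊ ∧ M` superimpose to `f`, then all their strings together
superimpose to the strings of `f`. Particles with label `0` may be given arbitrary strings. -/
theorem Represents.strands_sigma [PartialMonoid M] {n : ℕ} {p : Fin n → V}
    {x : Fin n → Smash IPlus M} {f : StringConfig V M}
    (h : Represents (Finset.univ.val.map fun i => (p i, x i)) f) {r : Fin n → ℕ}
    {y : ∀ i, Fin (r i) → Strand}
    (hy : ∀ i, label (x i) = 0 ∨
      (strings (x i)).val = Finset.univ.val.map fun s => (y i s : ℝ × ℝ)) :
    Represents (Finset.univ.val.map fun j : Σ i, Fin (r i) =>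
      ((p j.1, y j.1 j.2), label (x j.1))) (strands f) := by
  classical
  rintro ⟨v, J⟩
  have h1 : Interchangeable (labelsAt J.1 (labelsOver (Finset.univ.val.map fun i => (p i, x i)) v))
      (labelsAt J.1 {f.labels v}) :=
    -- The labels of a fixed string `J` are, up to interchangeability, invariant under the
    -- distributivity relations.
    SmashSum.labelsAt J.1 (interchangeable_smash_iff.1 (h v))
  have h2 : Interchangeable (labelsAt J.1 {f.labels v}) {(strands f).labels (v, J)} := by
    rw [labelsAt_singleton, strands_labels]
    split_ifs
    · exact Interchangeable.refl _
    · exact zero_interchangeable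
  refine Interchangeable.trans ?_ (h1.trans h2)
  rw [labelsOver_univ_map, labelsOver_univ_map, labelsAt_sum, Fintype.sum_sigma]
  refine Interchangeable.finset_sum _ fun i _ => ?_
  by_cases hv : p i = v
  · simp only [hv, if_true, labelsAt_singleton, Prod.mk.injEq, true_and]
    rcases hy i with h0 | h0
    -- A particle with label `0` has no strings, and the strings assigned to it only contribute
    -- summands `0`.
    · have hJ : J.1 ∉ strings (x i) := fun h => label_ne_zero h h0
      have h3 : Interchangeable (∑ s, if y i s = J then ({0} : Multiset M) else 0)
          (∑ s : Fin (r i), 0) := ?_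
      · rw [Finset.sum_const_zero] at h3
        rwa [if_neg hJ, h0]
      refine Interchangeable.finset_sum _ fun s _ => ?_
      split_ifs
      · exact zero_interchangeable.symm
      · exact Interchangeable.refl _
    · have h3 : ∑ s, (if y i s = J then ({label (x i)} : Multiset M) else 0) =
          ∑ J' ∈ strings (x i), if J' = J.1 then ({label (x i)} : Multiset M) else 0 := by
        rw [Finset.sum_eq_multiset_sum (strings (x i)), h0, Multiset.map_map]
        simp only [Function.comp_def, ← Subtype.ext_iff]
        rfl
      rw [h3, Finset.sum_ite_eq']
      exact Interchangeable.refl _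
  · simp only [hv, Prod.mk.injEq, false_and, if_false, labelsAt_zero, Finset.sum_const_zero]
    exact Interchangeable.refl _


variable [TopologicalSpace V] [TopologicalSpace M]

theorem IsTest.asString [PartialMonoid M] {K : Type*} [TopologicalSpace K]
    {F : K → StringConfig V M} (h : IsTest strands F) :
    IsTest (id : StringConfig V M → Config V (Smash IPlus M)) F := by
  obtain ⟨n, q, a, hq, ha, h⟩ := h
  refine ⟨n, fun k i => (q k i).1, fun k i => Smash.mk (q k i).2.toIPlus (a k i), by fun_prop,
    continuous_pi fun i => ?_, fun k => ?_⟩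
  · have h1 : Continuous fun k => (q k i).2.toIPlus :=
      Strand.continuous_toIPlus.comp (by fun_prop)
    exact continuous_smashMk.comp (h1.prodMk ((continuous_apply i).comp ha))
  · have := (h k).asString
    rwa [Multiset.map_map] at this

variable [T1Space M]

/-- Where the label is non-zero, the strings and the listed intervals can be compared by sums of
continuous functions, which vary continuously there. Without the alternative `label = 0` the set
need not be closed: when the label tends to `0` the strings vanish, but the list may converge. -/
theorem isClosed_enumerates [Zero M] {Z : Type*} [TopologicalSpace Z] {r : ℕ}
    {z : Z → Smash IPlus M} (hz : Continuous z) {y : Z → Fin r → ℝ × ℝ} (hy : Continuous y) :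
    IsClosed {k | label (z k) = 0 ∨ (strings (z k)).val = Finset.univ.val.map (y k)} := by
  have h1 : {k | label (z k) = 0 ∨ (strings (z k)).val = Finset.univ.val.map (y k)} =
      ⋂ φ : C(ℝ × ℝ, ℝ), {k | label (z k) = 0 ∨ ∑ J ∈ strings (z k), φ J = ∑ s, φ (y k s)} := by
    ext k
    simp only [mem_ofPred_eq, mem_iInter, forall_or_left]
    refine or_congr Iff.rfl ⟨fun h φ => ?_, fun h => eq_of_forall_sum_eq fun φ => ?_⟩
    · rw [Finset.sum_eq_multiset_sum, h, Multiset.map_map]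
      rfl
    · rw [Multiset.map_map]
      exact h φ
  rw [h1]
  refine isClosed_iInter fun φ => ⟨?_⟩
  have hopen : IsOpen {k | label (z k) ≠ 0} := isOpen_label_ne.preimage hz
  have h2 : ContinuousOn (fun k => ∑ J ∈ strings (z k), φ J - ∑ s, φ (y k s))
      {k | label (z k) ≠ 0} := by
    refine ContinuousOn.sub ?_ (Continuous.continuousOn (by fun_prop))
    exact (continuousOn_sum_strings φ.continuous.continuousOn).comp hz.continuousOn fun k hk => hk
  convert h2.isOpen_inter_preimage hopen (isOpen_compl_singleton (x := (0 : ℝ))) using 1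
  ext k
  simp [sub_eq_zero]

theorem exists_compact_strings [Zero M] {K : Type*} [TopologicalSpace K] [CompactSpace K] {n : ℕ}
    {x : K → Fin n → Smash IPlus M} (hx : Continuous x) :
    ∃ (R : ℕ) (C : Set (ℝ × ℝ)), IsCompact C ∧ (∀ J ∈ C, J.1 < J.2) ∧
      ∀ k i, (strings (x k i)).card ≤ R ∧ ∀ J ∈ strings (x k i), J ∈ C := by
  -- A bound for the sum of `φ` bounds the number of strings (through the summand `1`), their end
  -- points, and their lengths away from `0`.
  let φ : ℝ × ℝ → ℝ := fun J => 1 + |J.1| + |J.2| + (J.2 - J.1)⁻¹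
  have hφ : ContinuousOn φ {J | J.1 < J.2} := by
    refine ContinuousOn.add (by fun_prop) (ContinuousOn.inv₀ (by fun_prop) ?_)
    intro J hJ
    exact (sub_pos.2 hJ).ne'
  choose c hc using fun i =>
    exists_sum_strings_le (x := fun k => x k i) ((continuous_apply i).comp hx) hφ
  let d : ℝ := 1 + ∑ i, |c i|
  have hd : 0 < d := by positivity
  have hcd : ∀ i, c i ≤ d := fun i => by
    have h1 : |c i| ≤ ∑ i, |c i| :=
      Finset.single_le_sum (fun i _ => abs_nonneg (c i)) (Finset.mem_univ i)
    have := le_abs_self (c i)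
    linarith
  have hpos : ∀ {k i J}, J ∈ strings (x k i) → 0 < (J.2 - J.1)⁻¹ := fun hJ =>
    inv_pos.2 (sub_pos.2 (strings_lt hJ))
  have hone : ∀ {k i J}, J ∈ strings (x k i) → 1 ≤ φ J := fun {k i J} hJ => by
    have := hpos hJ
    have h1 := abs_nonneg J.1
    have h2 := abs_nonneg J.2
    simp only [φ]
    linarith
  have hsum : ∀ k i, ∑ J ∈ strings (x k i), φ J ≤ d := by
    intro k i
    by_cases h0 : label (x k i) = 0
    · have : strings (x k i) = ∅ := Finset.eq_empty_of_forall_notMem fun J hJ =>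
        label_ne_zero hJ h0
      rw [this, Finset.sum_empty]
      exact hd.le
    · exact (hc i k h0).trans (hcd i)
  refine ⟨⌈d⌉₊, (Icc (-d) d ×ˢ Icc (-d) d) ∩ {J | J.1 + d⁻¹ ≤ J.2},
    (isCompact_Icc.prod isCompact_Icc).inter_right (isClosed_le (by fun_prop) (by fun_prop)),
    fun J hJ => ?_, fun k i => ⟨?_, fun J hJ => ?_⟩⟩
  · have h1 : J.1 + d⁻¹ ≤ J.2 := hJ.2
    have := inv_pos.2 hd
    linarith
  · have h1 : ((strings (x k i)).card : ℝ) ≤ d := by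
      refine le_trans ?_ (hsum k i)
      rw [Finset.card_eq_sum_ones, Nat.cast_sum]
      exact Finset.sum_le_sum fun J hJ => by simpa using hone hJ
    exact_mod_cast h1.trans (Nat.le_ceil d)
  · have h1 : φ J ≤ d := (Finset.single_le_sum
      (fun J hJ => zero_le_one.trans (hone hJ)) hJ).trans (hsum k i)
    have h2 := hpos hJ
    have h3 := abs_nonneg J.1
    have h4 := abs_nonneg J.2
    simp only [φ] at h1
    refine ⟨⟨abs_le.1 (by linarith), abs_le.1 (by linarith)⟩, ?_⟩
    have h5 : d⁻¹ ≤ J.2 - J.1 := inv_le_of_inv_le₀ (sub_pos.2 (strings_lt hJ)) (by linarith)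
    change J.1 + d⁻¹ ≤ J.2
    linarith

/-- Families of strings are families of particles by `IsTest.asString`. Conversely, a compact family
of particles becomes a family of strings after pulling it back to a compact space of enumerations of
the strings, and openness descends along this quotient map. -/
theorem isGenerated_strands [PartialMonoid M] :
    IsGenerated (strands : StringConfig V M → Config (V × Strand) M) where
  continuous_of_isTest K _ _ _ F hF :=
    isGenerated_config.continuous_of_isTest K F hF.asString
  isOpen_of_isTest W hW := by
    refine isGenerated_config.isOpen_of_isTest W fun K _ _ _ F hF => ?_
    obtain ⟨n, p, x, hp, hx, hF⟩ := hF
    obtain ⟨R, C, hC, hClt, hxC⟩ := exists_compact_strings hx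
    have : CompactSpace C := isCompact_iff_compactSpace.1 hC
    -- `K`, with an enumeration of the strings of each particle
    let L : (Fin n → Fin (R + 1)) → Type max u v := fun r =>
      {y : K × (∀ i, Fin (r i) → C) // ∀ i, label (x y.1 i) = 0 ∨
        (strings (x y.1 i)).val = Finset.univ.val.map fun s => (y.2 i s : ℝ × ℝ)}
    have hL : ∀ r, CompactSpace (L r) := by
      intro r
      refine isCompact_iff_compactSpace.1 (IsClosed.isCompact ?_)
      have h1 : {y : K × (∀ i, Fin (r i) → C) | ∀ i, label (x y.1 i) = 0 ∨
          (strings (x y.1 i)).val = Finset.univ.val.map fun s => (y.2 i s : ℝ × ℝ)} =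
          ⋂ i, {y | label (x y.1 i) = 0 ∨
            (strings (x y.1 i)).val = Finset.univ.val.map fun s => (y.2 i s : ℝ × ℝ)} := by
        ext y
        simp
      change IsClosed {y : K × (∀ i, Fin (r i) → C) | ∀ i, label (x y.1 i) = 0 ∨
          (strings (x y.1 i)).val = Finset.univ.val.map fun s => (y.2 i s : ℝ × ℝ)}
      rw [h1]
      exact isClosed_iInter fun i => isClosed_enumerates (by fun_prop) (by fun_prop)
    let π : (Σ r, L r) → K := fun y => y.2.1.1
    have hπ : Continuous π := continuous_sigma fun r =>
      continuous_fst.comp continuous_subtype_val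
    have hsurj : Function.Surjective π := by
      intro k
      let e : ∀ i, Fin (strings (x k i)).card ≃ strings (x k i) := fun i =>
        (strings (x k i)).equivFin.symm
      -- Over each `k` there is an honest enumeration, of length at most `R` and with intervals in
      -- `C`.
      refine ⟨⟨fun i => ⟨(strings (x k i)).card, Nat.lt_succ_of_le (hxC k i).1⟩,
        ⟨(k, fun i s => ⟨(e i s).1, (hxC k i).2 _ (e i s).2⟩), fun i => Or.inr ?_⟩⟩, rfl⟩
      have h1 := Finset.map_univ_equiv (e i)
      have h2 := congrArg Finset.val (Finset.attach_map_val (s := strings (x k i)))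
      rw [← Finset.univ_eq_attach, ← h1, Finset.map_val, Finset.map_val, Multiset.map_map] at h2
      exact h2.symm
    -- Finitely many compact spaces `L r` map onto the Hausdorff space `K`, so `π` is closed and
    -- openness can be tested on each `L r`.
    have hquot := (hπ.isClosedMap).isQuotientMap hπ hsurj
    rw [← hquot.isOpen_preimage, isOpen_sigma_iff]
    intro r
    refine hW (L r) (fun y => F y.1.1) ?_
    refine IsTest.of_fintype (ι := Σ i, Fin (r i))
      (q := fun y j => (p y.1.1 j.1, (⟨(y.1.2 j.1 j.2).1, hClt _ (y.1.2 j.1 j.2).2⟩ : Strand)))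
      (a := fun y j => label (x y.1.1 j.1)) ?_ ?_ fun y => ?_
    · refine continuous_pi fun j => Continuous.prodMk (by fun_prop)
        (Continuous.subtype_mk (by fun_prop) _)
    · exact continuous_pi fun j => continuous_label.comp (by fun_prop)
    · exact (hF y.1.1).strands_sigma
        (y := fun i s => ⟨(y.1.2 i s).1, hClt _ (y.1.2 i s).2⟩) y.2

end StrandTopology

/-! ### Embeddings into a universe -/

section Universe

theorem eq_zero_of_smul_add_smul_mapDomain {E : Type*} [AddCommGroup E] [Module ℝ E] {σ : ℕ → ℕ}
    (hσ : Function.Injective σ) (hlt : ∀ n, n < σ n) {a : ℕ →₀ E} {c d : ℝ} (hd : d ≠ 0)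
    (h : c • a + d • a.mapDomain σ = 0) : a = 0 := by
  by_contra ha
  have hne := Finsupp.support_nonempty_iff.2 ha
  set n := a.support.max' hne
  have hn : a n ≠ 0 := Finsupp.mem_support_iff.1 (a.support.max'_mem hne)
  -- As `σ` raises indices, `σ n` lies beyond the largest index `n` of `a`, so the coordinate `σ n`
  -- only sees `d • a n`.
  have hσn : a (σ n) = 0 := by
    by_contra h0
    exact (hlt n).not_ge (a.support.le_max' _ (Finsupp.mem_support_iff.2 h0))
  have := DFunLike.congr_fun h (σ n)
  rw [Finsupp.add_apply, Finsupp.smul_apply, Finsupp.smul_apply, hσn,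
    Finsupp.mapDomain_apply hσ, smul_zero, zero_add, Finsupp.zero_apply] at this
  exact (smul_ne_zero hd hn) this

variable {G : Type w} [Group G] {V : Type u} [NormedAddCommGroup V]
  [InnerProductSpace ℝ V] [DistribMulAction G V]

/-- A shift of the summands of a universe. -/
structure Shift (G : Type w) [Group G] (V : Type u) [NormedAddCommGroup V]
    [InnerProductSpace ℝ V] [DistribMulAction G V] where
  toLinear : V →ₗ[ℝ] V
  continuous : Continuous toLinear
  equivariant : ∀ (g : G) x, toLinear (g • x) = g • toLinear x
  eq_zero : ∀ (c d : ℝ) x, d ≠ 0 → c • x + d • toLinear x = 0 → x = 0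

theorem Shift.injective (S : Shift G V) : Function.Injective S.toLinear := by
  refine (injective_iff_map_eq_zero _).2 fun x hx => S.eq_zero 0 1 x one_ne_zero ?_
  simpa using hx

theorem IsUniverse.exists_shifts [Fintype G] (hV : IsUniverse G V) :
    ∃ S T : Shift G V, ∀ x y, S.toLinear x = T.toLinear y → x = 0 ∧ y = 0 := by
  obtain ⟨φ, hinner, hφ⟩ := hV
  have key : ∀ σ : ℕ → ℕ, Function.Injective σ → (∀ n, n < σ n) →
      ∃ S : Shift G V, ∀ x, φ (S.toLinear x) = (φ x).mapDomain σ := by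
    intro σ hσ hlt
    let S : V →ₗ[ℝ] V := φ.symm.toLinearMap ∘ₗ Finsupp.lmapDomain (G → ℝ) ℝ σ ∘ₗ φ.toLinearMap
    have hS : ∀ x, φ (S x) = (φ x).mapDomain σ := fun x => by simp [S]
    refine ⟨⟨S, ?_, fun g x => φ.injective ?_, fun c d x hd h => ?_⟩, hS⟩
    · have hnorm : ∀ x, ‖S x‖ = ‖x‖ := by
        intro x
        rw [norm_eq_sqrt_real_inner, norm_eq_sqrt_real_inner, hinner, hinner, hS,
          Finsupp.sum_mapDomain_index_inj hσ]
        simp only [Finsupp.mapDomain_apply hσ]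
      exact AddMonoidHomClass.continuous_of_bound S 1 fun x => by rw [hnorm, one_mul]
    · ext n h
      rw [hφ, hS, hS]
      by_cases hn : n ∈ range σ
      · obtain ⟨m, rfl⟩ := hn
        rw [Finsupp.mapDomain_apply hσ, Finsupp.mapDomain_apply hσ, hφ]
      · rw [Finsupp.mapDomain_of_notMem_range _ _ hn, Finsupp.mapDomain_of_notMem_range _ _ hn]
        rfl
    · have := congrArg φ h
      rw [map_add, map_smul, map_smul, hS, map_zero] at this
      exact φ.map_eq_zero_iff.1 (eq_zero_of_smul_add_smul_mapDomain hσ hlt hd this)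
  -- Both `2n + 1` and `2n + 2` exceed `n` also for `n = 0`, and their ranges are disjoint.
  have h1 : Function.Injective fun n : ℕ => 2 * n + 1 := fun a b h => by simpa using h
  have h2 : Function.Injective fun n : ℕ => 2 * n + 2 := fun a b h => by simpa using h
  obtain ⟨S, hS⟩ := key _ h1 fun n => by omega
  obtain ⟨T, hT⟩ := key _ h2 fun n => by omega
  refine ⟨S, T, fun x y hxy => ?_⟩
  have h := congrArg φ hxy
  rw [hS, hT] at h
  have hx : φ x = 0 := by
    ext1 n
    have := DFunLike.congr_fun h (2 * n + 1)
    rw [Finsupp.mapDomain_apply h1, Finsupp.mapDomain_of_notMem_range] at this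
    · exact this
    · rintro ⟨m, hm⟩
      simp only at hm
      omega
  have hx : x = 0 := φ.map_eq_zero_iff.1 hx
  refine ⟨hx, T.injective ?_⟩
  rw [← hxy, hx, map_zero, map_zero]

/-! ### Homotopies through equivariant embeddings -/

/-- Equivariant injective maps. -/
def IsGInjective (G : Type w) {A B : Type*} [SMul G A] [SMul G B] (θ : A → B) : Prop :=
  Function.Injective θ ∧ ∀ (g : G) a, θ (g • a) = g • θ a

variable [SMulCommClass G ℝ V] {A : Type*} [SMul G A] [TopologicalSpace A]

/-- The linear map `(1 - t) + t S` has trivial kernel for every `t`: for `t ≠ 0` by `Shift.eq_zero`,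
and for `t = 0` it is the identity. -/
theorem Shift.homotopicThrough (S : Shift G V) {f : A → V} (hc : Continuous f)
    (hf : IsGInjective G f) : HomotopicThrough (IsGInjective G) f (S.toLinear ∘ f) := by
  have hS := S.continuous
  refine ⟨fun t a => (1 - t : ℝ) • f a + (t : ℝ) • S.toLinear (f a), by fun_prop, ?_, ?_,
    fun t => ⟨fun a b h => hf.1 ?_, fun g a => ?_⟩⟩
  · funext a
    simp
  · funext a
    simp
  · have h : (1 - t : ℝ) • f a + (t : ℝ) • S.toLinear (f a) =
      (1 - t : ℝ) • f b + (t : ℝ) • S.toLinear (f b) := h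
    by_cases ht : (t : ℝ) = 0
    · simpa [ht] using h
    · refine sub_eq_zero.1 (S.eq_zero (1 - t : ℝ) t _ ht ?_)
      rw [map_sub, smul_sub, smul_sub, sub_add_sub_comm, h, sub_self]
  · beta_reduce
    rw [hf.2, S.equivariant, smul_add, smul_comm g, smul_comm g]

/-- Any two equivariant embeddings into a universe are homotopic through equivariant
embeddings. -/
theorem IsUniverse.homotopicThrough [Fintype G] (hV : IsUniverse G V) {f g : A → V} (hfc : Continuous f)
    (hgc : Continuous g) (hf : IsGInjective G f) (hg : IsGInjective G g) :
    HomotopicThrough (IsGInjective G) f g := by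
  obtain ⟨S, T, hST⟩ := hV.exists_shifts
  refine (S.homotopicThrough hfc hf).trans (HomotopicThrough.trans ?_
    (T.homotopicThrough hgc hg).symm)
  have hS := S.continuous
  have hT := T.continuous
  refine ⟨fun t a => S.toLinear ((1 - t : ℝ) • f a) + T.toLinear ((t : ℝ) • g a), by fun_prop,
    ?_, ?_, fun t => ⟨fun a b h => ?_, fun c a => ?_⟩⟩
  · funext a
    simp
  · funext a
    simp
  · have h : S.toLinear ((1 - t : ℝ) • f a) + T.toLinear ((t : ℝ) • g a) =
      S.toLinear ((1 - t : ℝ) • f b) + T.toLinear ((t : ℝ) • g b) := h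
    have h1 : S.toLinear ((1 - t : ℝ) • f a - (1 - t : ℝ) • f b) =
        T.toLinear ((t : ℝ) • g b - (t : ℝ) • g a) := by
      rw [map_sub, map_sub, sub_eq_sub_iff_add_eq_add, h, add_comm]
    -- The images of `S` and `T` meet only in `0`, so both components agree; `g` separates points
    -- for `t ≠ 0`, and `f` for `t = 0`.
    obtain ⟨h2, h3⟩ := hST _ _ h1
    by_cases ht : (t : ℝ) = 0
    · rw [ht, sub_zero, one_smul, one_smul] at h2
      exact hf.1 (sub_eq_zero.1 h2)
    · rw [← smul_sub, smul_eq_zero] at h3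
      exact hg.1 (sub_eq_zero.1 (h3.resolve_left ht)).symm
  · beta_reduce
    rw [hf.2, hg.2, ← smul_comm c, ← smul_comm c, S.equivariant, T.equivariant, smul_add]

end Universe

/-! ### The maps in the theorem, and how they move the particles -/

section Actions

variable (G : Type w) [Group G]

/-- The trivial action. -/
abbrev trivialAction (X : Type*) : MulAction G X where
  smul _ x := x
  one_smul _ := rfl
  mul_smul _ _ _ := rfl

/-- The trivial action on intervals. -/
abbrev strandAction : MulAction G Strand := trivialAction G Strand

/-- The trivial action on the line. -/
abbrev realAction : MulAction G ℝ := trivialAction G ℝ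

attribute [local instance] strandAction realAction

variable {G} {V : Type u} {M : Type v} [PartialMonoid M]

section Moving

variable [MulAction G V] [SMulZeroClass G M]

theorem isEquivariantMap_config {A : Type u} [MulAction G A] :
    IsEquivariantMap G (id : Config A M → Config A M) :=
  ⟨Function.injective_id, fun _ _ => rfl, rfl⟩

theorem isEquivariantMap_strands (hM : ∀ (g : G) (a : M), g • a = 0 → a = 0) :
    IsEquivariantMap G (strands : StringConfig V M → Config (V × Strand) M) :=
  ⟨strands_injective, fun g f => strands_smul hM g f fun _ => rfl, strands_zero⟩

theorem IsEquivariantMap.pairMap {A : Type u} [MulAction G A] {X : Type max u v}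
    [Zero X] [SMul G X] {d : X → Config A M} (h : IsEquivariantMap G d) :
    IsEquivariantMap G (pairMap d d) where
  injective := by
    rintro ⟨x, y⟩ ⟨x', y'⟩ hxy
    refine Prod.ext (h.injective (Config.ext fun z => ?_)) (h.injective (Config.ext fun z => ?_))
    · simpa [LabeledStrings.pairMap] using
        congrArg (fun f : Config (A ⊕ A) M => f.labels (Sum.inl z)) hxy
    · simpa [LabeledStrings.pairMap] using
        congrArg (fun f : Config (A ⊕ A) M => f.labels (Sum.inr z)) hxy
  map_smul g z := by
    refine Config.ext ?_
    rintro (a | a)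
    · rw [Config.labels_smul, LabeledStrings.pairMap, LabeledStrings.pairMap, Sum.smul_inl,
        Config.pair_inl, Config.pair_inl, ← Config.labels_smul, ← h.map_smul]
      rfl
    · rw [Config.labels_smul, LabeledStrings.pairMap, LabeledStrings.pairMap, Sum.smul_inr,
        Config.pair_inr, Config.pair_inr, ← Config.labels_smul, ← h.map_smul]
      rfl
  map_zero := by
    refine Config.ext ?_
    rintro (a | a)
    · rw [LabeledStrings.pairMap, Config.pair_inl]
      exact congrArg (fun f : Config A M => f.labels a) h.map_zero
    · rw [LabeledStrings.pairMap, Config.pair_inr]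
      exact congrArg (fun f : Config A M => f.labels a) h.map_zero

end Moving

/-! ### Midpoints, and configurations that consist of strings -/

theorem midpt_mem {J : ℝ × ℝ} (h : J.1 < J.2) : midpt J ∈ Icc J.1 J.2 := by
  unfold midpt
  constructor <;> linarith

/-- The midpoint of a string. -/
noncomputable def strandMidpoint {V : Type*} (e : V × Strand) : V × ℝ := (e.1, midpt e.2.1)

theorem AreStrands.eq_of_midpt_eq {g : Config (V × Strand) M} (h : AreStrands g) {x : V}
    {J J' : Strand} (hJ : g.labels (x, J) ≠ 0) (hJ' : g.labels (x, J') ≠ 0)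
    (hm : midpt J.1 = midpt J'.1) : J = J' := by
  by_contra hne
  exact Set.disjoint_left.1 ((h x J J' hJ hJ').2 hne) (midpt_mem J.2) (hm ▸ midpt_mem J'.2)

theorem isPush_midpoints (f : StringConfig V M) :
    IsPush strandMidpoint (strands f) (midpoints f) where
  injOn := by
    rintro ⟨x, J⟩ ⟨x', J'⟩ h h' hh
    obtain rfl : x = x' := congrArg Prod.fst hh
    rw [(areStrands_strands f).eq_of_midpt_eq h h' (congrArg Prod.snd hh)]
  apply := by
    rintro ⟨x, J⟩ h
    rw [strands_apply (strands_ne_zero.1 h)]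
    exact if_pos ⟨J.1, strands_ne_zero.1 h, rfl⟩
  exists_of_ne := by
    classical
    rintro ⟨x, s⟩ hz
    have h : ∃ J ∈ strings (f.labels x), midpt J = s := by
      by_contra h0
      exact hz (if_neg h0)
    obtain ⟨J, hJ, rfl⟩ := h
    exact ⟨(x, ⟨J, strings_lt hJ⟩), strands_ne_zero.2 hJ, rfl⟩

/-- Only strings that end up over the same point restrict each other. Disjointness also yields
injectivity of the move, since no string is disjoint from itself. -/
theorem exists_isPush_strands {A : Type*} (S : A → V × Strand) (g : Config A M)
    (h : ∀ e e', g.labels e ≠ 0 → g.labels e' ≠ 0 → (S e).1 = (S e').1 → e ≠ e' →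
      g.labels e = g.labels e' ∧
        Disjoint (Icc (S e).2.1.1 (S e).2.1.2) (Icc (S e').2.1.1 (S e').2.1.2)) :
    ∃ f : StringConfig V M, IsPush S g (strands f) := by
  obtain ⟨g', hg'⟩ := exists_isPush S g fun e e' he he' hee => by
    by_contra hne
    have := (h e e' he he' (congrArg Prod.fst hee) hne).2
    rw [hee] at this
    exact Set.disjoint_left.1 this (midpt_mem (S e').2.2) (midpt_mem (S e').2.2)
  have hs : AreStrands g' := by
    intro x J J' hJ hJ'
    obtain ⟨e, he, h1⟩ := hg'.exists_of_ne _ hJ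
    obtain ⟨e', he', h1'⟩ := hg'.exists_of_ne _ hJ'
    rw [← h1, ← h1', hg'.apply e he, hg'.apply e' he']
    by_cases hne : e = e'
    · subst hne
      exact ⟨rfl, fun h0 => absurd (congrArg Prod.snd (h1.symm.trans h1')) h0⟩
    · have := h e e' he he' (by rw [h1, h1']) hne
      rw [h1, h1'] at this
      exact ⟨this.1, fun _ => this.2⟩
  obtain ⟨f, rfl⟩ := hs.exists_eq
  exact ⟨f, hg'⟩

theorem IsPush.strands {W : Type*} {θ : V → W} {f : StringConfig V M} {f' : StringConfig W M}
    (h : IsPush θ f f') :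
    IsPush (Prod.map θ id) (LabeledStrings.strands f) (LabeledStrings.strands f') := by
  have h0 : ∀ e : V × Strand, (LabeledStrings.strands f).labels e ≠ 0 → f.labels e.1 ≠ 0 := by
    intro e he h0
    rw [strands_ne_zero, h0, strings_zero] at he
    exact Finset.notMem_empty _ he
  constructor
  · rintro ⟨x, J⟩ ⟨x', J'⟩ he he' hee
    exact Prod.ext (h.injOn _ _ (h0 _ he) (h0 _ he') (Prod.ext_iff.1 hee).1)
      (Prod.ext_iff.1 hee).2
  · intro e he
    have h1 := h.apply _ (h0 e he)
    rw [strands_ne_zero] at he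
    rw [strands_apply he, strands_apply, Prod.map_fst, h1]
    rwa [Prod.map_fst, h1]
  · rintro ⟨y, J⟩ hy
    rw [strands_ne_zero] at hy
    have hy0 : f'.labels y ≠ 0 := by
      intro h0
      rw [h0, strings_zero] at hy
      exact Finset.notMem_empty _ hy
    obtain ⟨x, hx, rfl⟩ := h.exists_of_ne y hy0
    refine ⟨(x, J), ?_, rfl⟩
    rw [strands_ne_zero, ← h.apply x hx]
    exact hy

/-- Strings over two copies of `V` as strings over their disjoint union. -/
def sumStrand {V W : Type*} : (V × Strand) ⊕ (W × Strand) → (V ⊕ W) × Strand :=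
  Sum.elim (Prod.map Sum.inl id) (Prod.map Sum.inr id)

theorem isPush_sumStrand {W : Type*} (x : StringConfig V M) (y : StringConfig W M) :
    IsPush sumStrand ((strands x).pair (strands y)) (strands (x.pair y)) where
  injOn := by
    rintro (⟨a, J⟩ | ⟨a, J⟩) (⟨b, K⟩ | ⟨b, K⟩) - - h <;> simp_all [sumStrand]
  apply := by
    rintro (⟨a, J⟩ | ⟨a, J⟩) -
    · change (strands (x.pair y)).labels (Sum.inl a, J) = _
      rw [Config.pair_inl, strands_labels, strands_labels, Config.pair_inl]
    · change (strands (x.pair y)).labels (Sum.inr a, J) = _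
      rw [Config.pair_inr, strands_labels, strands_labels, Config.pair_inr]
  exists_of_ne := by
    rintro ⟨a | a, J⟩ h
    · refine ⟨Sum.inl (a, J), ?_, rfl⟩
      rw [strands_labels, Config.pair_inl] at h
      rwa [Config.pair_inl, strands_labels]
    · refine ⟨Sum.inr (a, J), ?_, rfl⟩
      rw [strands_labels, Config.pair_inr] at h
      rwa [Config.pair_inr, strands_labels]

end Actions

/-! ### The homotopies -/

section Main

attribute [local instance] strandAction realAction

theorem HomotopicThrough.comp {A B C : Type*} [TopologicalSpace A] [TopologicalSpace B]
    [TopologicalSpace C] {P : (A → B) → Prop} {Q : (C → B) → Prop} {f g : A → B}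
    (h : HomotopicThrough P f g) {μ : C → A} (hμ : Continuous μ) (hQ : ∀ θ, P θ → Q (θ ∘ μ)) :
    HomotopicThrough Q (f ∘ μ) (g ∘ μ) := by
  obtain ⟨Θ, hΘ, rfl, rfl, hP⟩ := h
  exact ⟨fun t => Θ t ∘ μ, hΘ.comp (f := fun q : unitInterval × C => (q.1, μ q.2)) (by fun_prop),
    rfl, rfl, fun t => hQ _ (hP t)⟩

theorem HomotopicThrough.mono {A B : Type*} [TopologicalSpace A] [TopologicalSpace B]
    {P Q : (A → B) → Prop} {f g : A → B} (h : HomotopicThrough P f g) (hQ : ∀ θ, P θ → Q θ) :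
    HomotopicThrough Q f g :=
  h.comp continuous_id hQ

theorem HomotopicThrough.prodMap {A B C : Type*} [TopologicalSpace A] [TopologicalSpace B]
    [TopologicalSpace C] {P : (A → B) → Prop} {Q : (A × C → B × C) → Prop} {f g : A → B}
    (h : HomotopicThrough P f g) (hQ : ∀ θ, P θ → Q (Prod.map θ id)) :
    HomotopicThrough Q (Prod.map f id) (Prod.map g id) := by
  obtain ⟨Θ, hΘ, rfl, rfl, hP⟩ := h
  exact ⟨fun t => Prod.map (Θ t) id, (hΘ.comp
    (f := fun q : unitInterval × (A × C) => (q.1, q.2.1)) (by fun_prop)).prodMk (by fun_prop),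
    rfl, rfl, fun t => hQ _ (hP t)⟩

variable {G : Type w} [Group G] {V : Type u} {M : Type v} [PartialMonoid M]

/-! ### Moves that preserve configurations of particles and strings -/

section Moves

variable [MulAction G V]

theorem IsGInjective.moves_config {A B : Type u} [MulAction G A] [MulAction G B] {θ : A → B}
    (h : IsGInjective G θ) :
    Moves G (id : Config A M → Config A M) (id : Config B M → Config B M) θ :=
  ⟨h.2, fun x => exists_isPush θ x fun _ _ _ _ hh => h.1 hh⟩

/-- Taking midpoints loses the lengths but does not identify two strings of one configuration, so an
injection of the midpoints suffices. -/
theorem IsGInjective.moves_pair_midpoints {B : Type u} [MulAction G B]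
    {θ : (V × ℝ) ⊕ (V × ℝ) → B} (h : IsGInjective G θ) :
    Moves G (pairMap (strands : StringConfig V M → _) (strands : StringConfig V M → _))
      (id : Config B M → Config B M) (θ ∘ Sum.map strandMidpoint strandMidpoint) := by
  refine ⟨?_, fun x => ?_⟩
  · rintro g (a | a)
    · exact h.2 g (Sum.inl (strandMidpoint a))
    · exact h.2 g (Sum.inr (strandMidpoint a))
  · obtain ⟨y, hy⟩ := exists_isPush θ (Config.pair (midpoints x.1) (midpoints x.2))
      fun _ _ _ _ hh => h.1 hh
    exact ⟨y, hy.comp ((isPush_midpoints x.1).pair (isPush_midpoints x.2))⟩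

/-- Different strings over one point of a configuration have different midpoints. So if two of them
still lie over one point after the move, only the second alternative is possible, and they inherit
equal labels and disjoint intervals. -/
theorem moves_strands {S : V × Strand → V × Strand} (hS : ∀ (g : G) e, S (g • e) = g • S e)
    (h : ∀ x J x' J', (S (x, J)).1 = (S (x', J')).1 →
      x = x' ∧ (midpt J.1 = midpt J'.1 ∨ (S (x, J)).2 = J ∧ (S (x', J')).2 = J')) :
    Moves G (strands : StringConfig V M → _) (strands : StringConfig V M → _) S := by
  refine ⟨hS, fun f => exists_isPush_strands S _ ?_⟩
  rintro ⟨x, J⟩ ⟨x', J'⟩ he he' hee hne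
  have hf := areStrands_strands f
  obtain ⟨rfl, h1⟩ := h x J x' J' hee
  have hJ : J ≠ J' := fun hJ => hne (by rw [hJ])
  obtain ⟨h2, h3⟩ := hf x J J' he he'
  rcases h1 with h1 | ⟨h1, h1'⟩
  · exact absurd (hf.eq_of_midpt_eq he he' h1) hJ
  · rw [h1, h1']
    exact ⟨h2, h3 hJ⟩

theorem IsGInjective.moves_strands {θ : V → V} (h : IsGInjective G θ) :
    Moves G (strands : StringConfig V M → _) (strands : StringConfig V M → _)
      (Prod.map θ id) :=
  LabeledStrings.moves_strands (fun g e => Prod.ext (h.2 g e.1) rfl)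
    fun _ _ _ _ hx => ⟨h.1 hx, Or.inr ⟨rfl, rfl⟩⟩

end Moves

/-! ### Hopf structures given by moves -/

theorem isHopfGSpace_of_isPush [TopologicalSpace M] [SMulZeroClass G M] {A : Type u}
    [TopologicalSpace A] [MulAction G A] {X : Type max u v} [TopologicalSpace X] [Zero X]
    [SMul G X] {d : X → Config A M} (hM : ∀ (g : G) (a : M), g • a = 0 → a = 0)
    (hd : IsEquivariantMap G d) (h : IsGenerated d) {θ : A ⊕ A → A} (hc : Continuous θ)
    (hθ : ∀ (g : G) a, θ (g • a) = g • θ a) {m : X → X → X}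
    (hm : ∀ z, IsPush θ (pairMap d d z) (d (m z.1 z.2)))
    (hl : HomotopicThrough (Moves G d d) (θ ∘ Sum.inl) id)
    (hr : HomotopicThrough (Moves G d d) (θ ∘ Sum.inr) id) : IsHopfGSpace G m := by
  have h2 := h.isKGenerated_prod h
  refine ⟨h2.kContinuous h hc hm, fun g x y =>
    smul_eq_of_isPush hM hd.pairMap hd hθ (f := fun z : X × X => m z.1 z.2) hm g (x, y),
    zero_eq_of_isPush (hd.pairMap (G := G)) hd (f := fun z : X × X => m z.1 z.2) hm,
    gHomotopic_of_isPush hM hd hd h.isKGenerated h hl (fun x => ?_) fun x => IsPush.id _,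
    gHomotopic_of_isPush hM hd hd h.isKGenerated h hr (fun x => ?_) fun x => IsPush.id _⟩
  · have := hm (x, 0)
    rw [pairMap, hd.map_zero] at this
    -- Multiplying by the unit amounts to moving along one half of `θ`.
    exact this.comp (IsPush.inl (d x))
  · have := hm (0, x)
    rw [pairMap, hd.map_zero] at this
    exact this.comp (IsPush.inr (d x))

theorem continuous_strandMidpoint [TopologicalSpace V] : Continuous (strandMidpoint : V × Strand → V × ℝ) := by
  unfold strandMidpoint midpt
  fun_prop

theorem isGInjective_id [MulAction G V] : IsGInjective G (id : V → V) :=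
  ⟨Function.injective_id, fun _ _ => rfl⟩

/-! ### The map `λ` and the multiplications as moves -/

variable [NormedAddCommGroup V] [InnerProductSpace ℝ V] [DistribMulAction G V]

theorem GIsometry.continuous_app (l : GIsometry G V) :
    Continuous fun q : V × V => l.app q.1 q.2 :=
  l.toIsometry.continuous.comp (WithLp.prod_continuous_toLp 2 V V)

theorem GIsometry.app_smul (l : GIsometry G V) (g : G) (x y : V) :
    l.app (g • x) (g • y) = g • l.app x y := l.equivariant g x y

theorem LineEmbedding.continuous (e : LineEmbedding G V) : Continuous e.toLinear :=
  e.toLinear.continuous_of_finiteDimensional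

theorem continuous_position (e : LineEmbedding G V) (l : GIsometry G V) :
    Continuous (position e l) := by
  have := e.continuous
  exact l.continuous_app.comp (f := fun q : V × ℝ => (q.1, e.toLinear q.2)) (by fun_prop)

theorem isGInjective_position (e : LineEmbedding G V) (l : GIsometry G V) :
    IsGInjective G (position e l) := by
  refine ⟨(position e l).injective, fun g q => ?_⟩
  change l.app (g • q.1) (e.toLinear q.2) = g • l.app q.1 (e.toLinear q.2)
  rw [← l.app_smul, e.fixed]

theorem HopfChoice.continuous_embedding (j : HopfChoice G V) : Continuous j.embedding := by
  have := j.isom.continuous_app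
  refine continuous_sum_dom.2 ⟨?_, ?_⟩
  · exact this.comp (f := fun x => (j.pt₁, x)) (by fun_prop)
  · exact this.comp (f := fun x => (j.pt₂, x)) (by fun_prop)

theorem HopfChoice.isGInjective_embedding (j : HopfChoice G V) : IsGInjective G j.embedding := by
  refine ⟨j.embedding.injective, ?_⟩
  rintro g (x | x)
  · change j.isom.app j.pt₁ (g • x) = g • j.isom.app j.pt₁ x
    rw [← j.isom.app_smul, j.fixed₁]
  · change j.isom.app j.pt₂ (g • x) = g • j.isom.app j.pt₂ x
    rw [← j.isom.app_smul, j.fixed₂]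

theorem isPush_lambda (e : LineEmbedding G V) (l : GIsometry G V) (f : StringConfig V M) :
    IsPush (position e l ∘ strandMidpoint) (strands f) (lambda e l f) :=
  (IsPush.embDomain (position e l) (midpoints f)).comp (isPush_midpoints f)

theorem isPush_hopfMul (j : HopfChoice G V) (x y : Config V M) :
    IsPush j.embedding (x.pair y) (hopfMul j x y) := IsPush.embDomain j.embedding (x.pair y)

/-- The way the multiplication moves strings. -/
noncomputable def HopfChoice.strandMap (j : HopfChoice G V) :
    (V × Strand) ⊕ (V × Strand) → V × Strand :=
  Prod.map j.embedding id ∘ sumStrand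

theorem isPush_strands_hopfMul (j : HopfChoice G V) (x y : StringConfig V M) :
    IsPush j.strandMap ((strands x).pair (strands y)) (strands (hopfMul j x y)) :=
  (IsPush.embDomain j.embedding (x.pair y)).strands.comp (isPush_sumStrand x y)

theorem HopfChoice.continuous_strandMap (j : HopfChoice G V) : Continuous j.strandMap := by
  refine (j.continuous_embedding.prodMap continuous_id).comp (continuous_sum_dom.2 ⟨?_, ?_⟩)
  · exact continuous_inl.prodMap continuous_id
  · exact continuous_inr.prodMap continuous_id

theorem HopfChoice.strandMap_smul (j : HopfChoice G V) (g : G) (a : (V × Strand) ⊕ (V × Strand)) :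
    j.strandMap (g • a) = g • j.strandMap a := by
  rcases a with a | a
  · exact Prod.ext (j.isGInjective_embedding.2 g (Sum.inl a.1)) rfl
  · exact Prod.ext (j.isGInjective_embedding.2 g (Sum.inr a.1)) rfl

theorem HopfChoice.isGInjective_inl (j : HopfChoice G V) : IsGInjective G (j.embedding ∘ Sum.inl) :=
  ⟨j.embedding.injective.comp Sum.inl_injective, fun g x =>
    j.isGInjective_embedding.2 g (Sum.inl x)⟩

theorem HopfChoice.isGInjective_inr (j : HopfChoice G V) : IsGInjective G (j.embedding ∘ Sum.inr) :=
  ⟨j.embedding.injective.comp Sum.inr_injective, fun g x =>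
    j.isGInjective_embedding.2 g (Sum.inr x)⟩

theorem isHopfGSpace_config [Fintype G] [SMulCommClass G ℝ V] [TopologicalSpace M]
    [SMulZeroClass G M] (hM : ∀ (g : G) (a : M), g • a = 0 → a = 0) (hV : IsUniverse G V)
    (j : HopfChoice G V) :
    IsHopfGSpace G (hopfMul j : Config V M → Config V M → Config V M) :=
  isHopfGSpace_of_isPush hM isEquivariantMap_config isGenerated_config j.continuous_embedding
    j.isGInjective_embedding.2 (fun z => isPush_hopfMul j z.1 z.2)
    ((hV.homotopicThrough (j.continuous_embedding.comp continuous_inl) continuous_id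
      j.isGInjective_inl isGInjective_id).mono fun _ h => h.moves_config)
    ((hV.homotopicThrough (j.continuous_embedding.comp continuous_inr) continuous_id
      j.isGInjective_inr isGInjective_id).mono fun _ h => h.moves_config)

theorem isHopfGSpace_strings [Fintype G] [SMulCommClass G ℝ V] [TopologicalSpace M] [T1Space M]
    [SMulZeroClass G M] (hM : ∀ (g : G) (a : M), g • a = 0 → a = 0) (hV : IsUniverse G V)
    (j : HopfChoice G V) :
    IsHopfGSpace G (hopfMul j : StringConfig V M → StringConfig V M → StringConfig V M) :=
  isHopfGSpace_of_isPush hM (isEquivariantMap_strands hM) isGenerated_strands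
    j.continuous_strandMap j.strandMap_smul (fun z => isPush_strands_hopfMul j z.1 z.2)
    ((hV.homotopicThrough (j.continuous_embedding.comp continuous_inl) continuous_id
      j.isGInjective_inl isGInjective_id).prodMap fun _ h => h.moves_strands)
    ((hV.homotopicThrough (j.continuous_embedding.comp continuous_inr) continuous_id
      j.isGInjective_inr isGInjective_id).prodMap fun _ h => h.moves_strands)

theorem isPointedGMap_lambda [TopologicalSpace M] [T1Space M] [SMulZeroClass G M]
    (hM : ∀ (g : G) (a : M), g • a = 0 → a = 0)
    (e : LineEmbedding G V) (l : GIsometry G V) :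
    IsPointedGMap G (lambda e l : StringConfig V M → Config V M) :=
  isPointedGMap_of_isPush hM (isEquivariantMap_strands hM) isEquivariantMap_config
    isGenerated_strands isGenerated_config
    ((continuous_position e l).comp continuous_strandMidpoint)
    (fun g a => (isGInjective_position e l).2 g (strandMidpoint a)) (isPush_lambda e l)

/-- Both composites move the midpoints of two configurations by equivariant embeddings of two copies
of `V × ℝ` into `V`, and such embeddings are homotopic. The choices `j` and `j'` need not be
related. -/
theorem isHopfGMap_lambda [Fintype G] [SMulCommClass G ℝ V] [TopologicalSpace M] [T1Space M]
    [SMulZeroClass G M] (hM : ∀ (g : G) (a : M), g • a = 0 → a = 0) (hV : IsUniverse G V)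
    (e : LineEmbedding G V) (l : GIsometry G V) (j j' : HopfChoice G V) :
    IsHopfGMap G (hopfMul j : StringConfig V M → StringConfig V M → StringConfig V M)
        (hopfMul j' : Config V M → Config V M → Config V M) (lambda e l) := by
  refine ⟨isPointedGMap_lambda hM e l, ?_⟩
  have hp := continuous_position e l
  have hpi := isGInjective_position e l
  -- the two embeddings of two copies of `V × ℝ` into `V`
  let f₀ : (V × ℝ) ⊕ (V × ℝ) → V := Sum.elim
    (fun q => position e l (j.embedding (Sum.inl q.1), q.2))
    (fun q => position e l (j.embedding (Sum.inr q.1), q.2))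
  let f₁ : (V × ℝ) ⊕ (V × ℝ) → V := j'.embedding ∘ Sum.map (position e l) (position e l)
  have hc₀ : Continuous f₀ := by
    have := j.continuous_embedding
    refine continuous_sum_dom.2 ⟨hp.comp (f := fun q : V × ℝ => (j.embedding (Sum.inl q.1), q.2))
      (by fun_prop), hp.comp (f := fun q : V × ℝ => (j.embedding (Sum.inr q.1), q.2))
      (by fun_prop)⟩
  have hc₁ : Continuous f₁ := j'.continuous_embedding.comp (hp.sumMap hp)
  have hi₀ : IsGInjective G f₀ := by
    refine ⟨?_, ?_⟩
    · rintro (⟨x, s⟩ | ⟨x, s⟩) (⟨y, t⟩ | ⟨y, t⟩) h <;>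
      · have h := hpi.1 h
        have h1 := j.embedding.injective (congrArg Prod.fst h)
        have h2 := congrArg Prod.snd h
        simp_all
    · rintro g (q | q)
      · refine Eq.trans ?_ (hpi.2 g (j.embedding (Sum.inl q.1), q.2))
        exact congrArg (fun x => position e l (x, q.2)) (j.isGInjective_inl.2 g q.1)
      · refine Eq.trans ?_ (hpi.2 g (j.embedding (Sum.inr q.1), q.2))
        exact congrArg (fun x => position e l (x, q.2)) (j.isGInjective_inr.2 g q.1)
  have hi₁ : IsGInjective G f₁ := by
    refine ⟨j'.embedding.injective.comp (hpi.1.sumMap hpi.1), ?_⟩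
    rintro g (q | q)
    · refine Eq.trans ?_ (j'.isGInjective_inl.2 g (position e l q))
      exact congrArg (fun x => j'.embedding (Sum.inl x)) (hpi.2 g q)
    · refine Eq.trans ?_ (j'.isGInjective_inr.2 g (position e l q))
      exact congrArg (fun x => j'.embedding (Sum.inr x)) (hpi.2 g q)
  have hμ : Continuous (Sum.map (strandMidpoint : V × Strand → V × ℝ)
      (strandMidpoint : V × Strand → V × ℝ)) :=
    continuous_strandMidpoint.sumMap continuous_strandMidpoint
  refine gHomotopic_of_isPush hM (isEquivariantMap_strands hM).pairMap isEquivariantMap_config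
    (isGenerated_strands.isKGenerated_prod isGenerated_strands) isGenerated_config
    ((hV.homotopicThrough hc₀ hc₁ hi₀ hi₁).comp hμ fun θ h => h.moves_pair_midpoints)
    (fun z => ?_) fun z => ?_
  · convert (isPush_lambda e l (hopfMul j z.1 z.2)).comp (isPush_strands_hopfMul j z.1 z.2) using 1
    · funext a
      rcases a with a | a <;> rfl
    · rfl
    · rfl
  · convert (isPush_hopfMul j' (lambda e l z.1) (lambda e l z.2)).comp
      ((isPush_lambda e l z.1).pair (isPush_lambda e l z.2)) using 1
    · funext a
      rcases a with a | a <;> rfl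
    · rfl
    · rfl

/-! ### The homotopy inverse of `λ` -/

/-- The interval `[-1, 1]`. -/
def unitStrand : Strand := ⟨(-1, 1), by norm_num⟩

/-- Affine interpolation between intervals. -/
noncomputable def interpolate (t : unitInterval) (J K : Strand) : Strand :=
  ⟨(1 - t : ℝ) • J.1 + (t : ℝ) • K.1, by
    have h1 := J.2
    have h2 := K.2
    have h3 := t.2.1
    have h4 := t.2.2
    simp only [Prod.fst_add, Prod.snd_add, Prod.smul_fst, Prod.smul_snd, smul_eq_mul]
    -- At `t = 0` the strict inequality comes from `J`, for `t > 0` from `K`.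
    rcases h3.eq_or_lt with h0 | h0
    · rw [← h0]
      linarith
    · have := mul_lt_mul_of_pos_left h2 h0
      have := mul_le_mul_of_nonneg_left h1.le (sub_nonneg.2 h4)
      linarith⟩

theorem homotopicThrough_strands [Fintype G] [SMulCommClass G ℝ V] (hV : IsUniverse G V)
    (e : LineEmbedding G V) (l : GIsometry G V) :
    HomotopicThrough (Moves G (strands : StringConfig V M → _) (strands : StringConfig V M → _))
      (fun a : V × Strand => (position e l (strandMidpoint a), unitStrand)) id := by
  have hp := continuous_position e l
  have hpi := isGInjective_position e l
  have hm := continuous_strandMidpoint (V := V)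
  -- first the intervals are restored
  have h1 : HomotopicThrough
      (Moves G (strands : StringConfig V M → _) (strands : StringConfig V M → _))
      (fun a : V × Strand => (position e l (strandMidpoint a), unitStrand))
      (fun a => (position e l (strandMidpoint a), a.2)) := by
    refine ⟨fun t a => (position e l (strandMidpoint a), interpolate t unitStrand a.2),
      (hp.comp (hm.comp continuous_snd)).prodMk (Continuous.subtype_mk (by fun_prop) _), ?_, ?_,
      fun t => moves_strands (fun g a => ?_) fun x J x' J' hx => ?_⟩
    · funext a
      exact Prod.ext rfl (Subtype.ext (by simp [interpolate]))
    · funext a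
      exact Prod.ext rfl (Subtype.ext (by simp [interpolate]))
    · exact Prod.ext (hpi.2 g (strandMidpoint a)) rfl
    · have := hpi.1 hx
      -- Strings over the same point have the same original point and midpoint, so different strings
      -- lie over different points and their intervals are unrestricted.
      exact ⟨congrArg Prod.fst this, Or.inl (congrArg Prod.snd this)⟩
  -- then the strings over different points of a line are moved to one point of it
  have h2 : HomotopicThrough
      (Moves G (strands : StringConfig V M → _) (strands : StringConfig V M → _))
      (fun a : V × Strand => (position e l (strandMidpoint a), a.2))
      (Prod.map (fun x => position e l (x, 0)) id) := by
    refine ⟨fun t a => (position e l (a.1, (1 - t : ℝ) * midpt a.2.1), a.2),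
      (hp.comp (f := fun q : unitInterval × (V × Strand) =>
        (q.2.1, (1 - q.1 : ℝ) * midpt q.2.2.1)) ?_).prodMk (by fun_prop), ?_, ?_,
      fun t => moves_strands (fun g a => ?_) fun x J x' J' hx => ?_⟩
    · unfold midpt
      fun_prop
    · funext a
      simp [strandMidpoint]
    · funext a
      simp [Prod.map]
    · exact Prod.ext (hpi.2 g (a.1, (1 - t : ℝ) * midpt a.2.1)) rfl
    -- Strings can meet over one point only if they were over one point originally; their intervals,
    -- being the original ones, are still disjoint.
    · exact ⟨congrArg Prod.fst (hpi.1 hx), Or.inr ⟨rfl, rfl⟩⟩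
  have hi : IsGInjective G fun x : V => position e l (x, 0) :=
    ⟨fun x y h => congrArg Prod.fst (hpi.1 h), fun g x => hpi.2 g (x, 0)⟩
  -- The base points are now moved by the embedding `x ↦ l(x, 0)` of `V`, which is deformed to the
  -- identity.
  have h3 := (hV.homotopicThrough (hp.comp (f := fun x : V => (x, (0 : ℝ))) (by fun_prop))
    continuous_id hi isGInjective_id).prodMap (C := Strand)
      (Q := Moves G (strands : StringConfig V M → _) (strands : StringConfig V M → _))
      fun _ h => h.moves_strands
  exact h1.trans (h2.trans h3)

theorem isGHomotopyEquiv_lambda [Fintype G] [SMulCommClass G ℝ V] [TopologicalSpace M] [T1Space M]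
    [SMulZeroClass G M] (hM : ∀ (g : G) (a : M), g • a = 0 → a = 0) (hV : IsUniverse G V)
    (e : LineEmbedding G V) (l : GIsometry G V) :
    IsGHomotopyEquiv G (lambda e l : StringConfig V M → Config V M) := by
  have hp := continuous_position e l
  have hpi := isGInjective_position e l
  have hex : ∀ g : Config V M, ∃ f : StringConfig V M,
      IsPush (fun x => (x, unitStrand)) g (strands f) := fun g =>
    -- There is at most one string over each point, so no condition arises.
    exists_isPush_strands _ g fun x y _ _ h hne => absurd h hne
  choose ι hι using hex
  refine ⟨isPointedGMap_lambda hM e l, ι, isPointedGMap_of_isPush hM isEquivariantMap_config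
    (isEquivariantMap_strands hM) isGenerated_config isGenerated_strands
    (θ := fun x => (x, unitStrand)) (by fun_prop) (fun g x => rfl) hι, ?_, ?_⟩
  · exact gHomotopic_of_isPush hM (isEquivariantMap_strands hM) (isEquivariantMap_strands hM)
      isGenerated_strands.isKGenerated isGenerated_strands (homotopicThrough_strands hV e l)
      (fun f => (hι _).comp (isPush_lambda e l f)) fun f => IsPush.id _
  · have hc : Continuous fun x : V => position e l (strandMidpoint (x, unitStrand)) :=
      hp.comp (continuous_strandMidpoint.comp (by fun_prop))
    have hi : IsGInjective G fun x : V => position e l (strandMidpoint (x, unitStrand)) :=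
      ⟨fun x y h => congrArg Prod.fst (hpi.1 h), fun g x => hpi.2 g (x, midpt unitStrand.1)⟩
    exact gHomotopic_of_isPush hM isEquivariantMap_config isEquivariantMap_config
      isGenerated_config.isKGenerated isGenerated_config
      ((hV.homotopicThrough hc continuous_id hi isGInjective_id).mono fun _ h => h.moves_config)
      (fun f => (isPush_lambda e l (ι f)).comp (hι f)) fun f => IsPush.id _

end Main

end LabeledStrings

theorem mainTheorem4 {G : Type w} [Group G] [Fintype G]
    {V : Type u} [NormedAddCommGroup V] [InnerProductSpace ℝ V] [DistribMulAction G V]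
    [SMulCommClass G ℝ V] [IsIsometricSMul G V] (hV : IsUniverse G V)
    {M : Type v} [TopologicalSpace M] [T1Space M] [PartialMonoid M] [GPartialMonoid G M]
    (e : LineEmbedding G V) (l : GIsometry G V) :
    IsGHomotopyEquiv G (lambda e l : StringConfig V M → Config V M) ∧
    ∀ j j' : HopfChoice G V,
      IsHopfGSpace G (hopfMul j : StringConfig V M → StringConfig V M → StringConfig V M) ∧
      IsHopfGSpace G (hopfMul j' : Config V M → Config V M → Config V M) ∧
      IsHopfGMap G (hopfMul j : StringConfig V M → StringConfig V M → StringConfig V M)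
        (hopfMul j' : Config V M → Config V M → Config V M) (lambda e l) := by
  have hM : ∀ (g : G) (a : M), g • a = 0 → a = 0 := fun g a h => by
    rw [← inv_smul_smul g a, h, smul_zero]
  exact ⟨isGHomotopyEquiv_lambda hM hV e l, fun j j' => ⟨isHopfGSpace_strings hM hV j,
    isHopfGSpace_config hM hV j', isHopfGMap_lambda hM hV e l j j'⟩⟩
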